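/- Notation. For $\alpha\in\mathbb N^n$ write $|\alpha|=\sum\alpha_i$, $\alpha!=\prod\alpha_i!$; $\langle\xi\rangle=(1+|\xi|^2)^{1/2}$; $\hat f(\xi)=\int e^{-ix\cdot\xi}f(x)\,dx$. Let $\sigma>1$. A function $f\in C^\infty(\mathbb R^n)$ belongs to $\gamma^\sigma(\mathbb R^n)$ if for every compact $K\subset\mathbb R^n$ there is $C>0$ with $|\partial^\alpha f(x)|\le C^{|\alpha|+1}(\alpha!)^\sigma$ for all $x\in K$, $\alpha\in\mathbb N^n$. For $\eta\in(0,1]$, a net $(f_\varepsilon)_{\varepsilon\in(0,\eta]}$ in $\gamma^\sigma(\mathbb R^n)$ is $\gamma^\sigma$-moderate if for every compact $K$ there are $c>0$ and $N\in\mathbb N$ with $|\partial^\alpha f_\varepsilon(x)|\le c^{|\alpha|+1}(\alpha!)^\sigma\varepsilon^{-N-|\alpha|}$ for all $\alpha\in\mathbb N^n$, $x\in K$, $\varepsilon\in(0,\eta]$; it is $\gamma^\sigma_c$-moderate if in addition all $f_\varepsilon$ are supported in one compact set. Let $\mathcal S^{(\sigma)}(\mathbb R^n)$ be the space of all $\varphi\in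 C^\infty(\mathbb R^n)$ (complex valued) such that $$\sup_{\alpha,\beta\in\mathbb N^n}\int_{\mathbb R^n}\frac{|x^\beta|}{b^{|\alpha+\beta|}(\alpha!)^\sigma(\beta!)^\sigma}|\partial^\alpha\varphi(x)|\,dx<\infty\quad\text{for all } b>0.$$ Let $\phi\in\mathcal S^{(\sigma)}(\mathbb R^n)$ satisfy $\int\phi=1$ and $\int x^\alpha\phi(x)\,dx=0$ for all $\alpha\ne0$. Let $\chi\in\gamma^\sigma(\mathbb R^n)$ be real valued with $0\le\chi\le1$, $\chi(x)=0$ for $|x|\ge2$ and $\chi(x)=1$ for $|x|\le1$. Put $$\rho_\varepsilon(x)=\varepsilon^{-n}\phi(x/\varepsilon)\,\chi(x|\log\varepsilon|),\qquad \varepsilon\in(0,1).$$ Proposition. Let $u\in\mathcal E'(\mathbb R^n)$ be a (complex valued) distribution with compact support. Then there is $\eta\in(0,1)$ such that the convolutions $u*\rho_\varepsilon$, $\varepsilon\in(0,\eta]$, are smooth functions and: (a) there is a compact set $K\subset\mathbb R^n$ with $\operatorname{supp}(u*\rho_\varepsilon)\subseteq K$ for all $\varepsilon\in(0,\eta]$;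 (b) there are $C>0$ and $N\in\mathbb N$ such that $$|\partial^\alpha(u*\rho_\varepsilon)(x)|\le C^{|\alpha|+1}(\alpha!)^\sigma\varepsilon^{-|\alpha|-N}\quad\text{for all }\alpha\in\mathbb N^n,\ x\in\mathbb R^n,\ \varepsilon\in(0,\eta];$$ (c) the net $(u*\rho_\varepsilon)_{\varepsilon\in(0,\eta]}$ is $\gamma^\sigma_c$-moderate; (d) there are $c>0$ and $N\in\mathbb N$ such that $$|\widehat{u*\rho_\varepsilon}(\xi)|\le c\,\varepsilon^{-N}e^{-c\,\varepsilon^{1/\sigma}\langle\xi\rangle^{1/\sigma}}\quad\text{for all }\xi\in\mathbb R^n,\ \varepsilon\in(0,\eta].$$ -/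

import Mathlib

open scoped ContDiff Distributions FourierTransform

noncomputable section

namespace GevreyReg

/-- The Euclidean space `ℝⁿ`. -/
abbrev Rn (n : ℕ) : Type := EuclideanSpace ℝ (Fin n)

/-- The length `|α| = α₁ + ⋯ + αₙ` of a multi-index. -/
def mlen {n : ℕ} (α : Fin n → ℕ) : ℕ := ∑ i, α i

/-- The factorial `α! = α₁! ⋯ αₙ!` of a multi-index, as a real number. -/
def mfact {n : ℕ} (α : Fin n → ℕ) : ℝ := ∏ i, ((α i).factorial : ℝ)

/-- The monomial `x^β = x₁^β₁ ⋯ xₙ^βₙ`. -/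
def mmon {n : ℕ} (β : Fin n → ℕ) (x : Rn n) : ℝ := ∏ i, x i ^ β i

/-- The partial derivative `∂^α f (x)`: the `|α|`-th derivative of `f` at `x`, applied to the list of
basis vectors in which `e_i` occurs exactly `α i` times (first `α 0` times `e_0`, then `α 1` times
`e_1`, and so on). -/
def mderiv {n : ℕ} {F : Type*} [NormedAddCommGroup F] [NormedSpace ℝ F]
    (α : Fin n → ℕ) (f : Rn n → F) (x : Rn n) : F :=
  iteratedFDeriv ℝ (∑ i, α i) f x
    (fun k => EuclideanSpace.single (finSigmaFinEquiv.symm k).1 (1 : ℝ))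

/-- The Gevrey (Roumieu) class `γ^σ(ℝⁿ)`. -/
def IsGevrey {n : ℕ} {F : Type*} [NormedAddCommGroup F] [NormedSpace ℝ F]
    (σ : ℝ) (f : Rn n → F) : Prop :=
  ContDiff ℝ ∞ f ∧
    ∀ K : Set (Rn n), IsCompact K → ∃ C : ℝ, 0 < C ∧ ∀ α : Fin n → ℕ, ∀ x ∈ K,
      ‖mderiv α f x‖ ≤ C ^ (mlen α + 1) * mfact α ^ σ

/-- A net `(f_ε)_{ε ∈ (0, η]}` is `γ^σ`-moderate. -/
def IsGevreyModerate {n : ℕ} (σ η : ℝ) (f : ℝ → Rn n → ℂ) : Prop :=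
  (∀ ε ∈ Set.Ioc 0 η, IsGevrey σ (f ε)) ∧
    ∀ K : Set (Rn n), IsCompact K → ∃ c : ℝ, 0 < c ∧ ∃ N : ℕ,
      ∀ α : Fin n → ℕ, ∀ x ∈ K, ∀ ε ∈ Set.Ioc 0 η,
        ‖mderiv α (f ε) x‖ ≤
          c ^ (mlen α + 1) * mfact α ^ σ * ε ^ (-(N : ℤ) - (mlen α : ℤ))

/-- A net `(f_ε)_{ε ∈ (0, η]}` is `γ^σ_c`-moderate: it is `γ^σ`-moderate and all its members are
supported in one compact set. -/
def IsGevreyCModerate {n : ℕ} (σ η : ℝ) (f : ℝ → Rn n → ℂ) : Prop :=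
  IsGevreyModerate σ η f ∧
    ∃ K : Set (Rn n), IsCompact K ∧ ∀ ε ∈ Set.Ioc 0 η, tsupport (f ε) ⊆ K

/-- The norm `‖φ‖_{b,σ} = sup_{α,β} ∫ |x^β| |∂^α φ(x)| / (b^{|α+β|} α!^σ β!^σ) dx`. -/
def gsNorm {n : ℕ} (b σ : ℝ) (φ : Rn n → ℂ) : ENNReal :=
  ⨆ (α : Fin n → ℕ) (β : Fin n → ℕ), ∫⁻ x : Rn n, ENNReal.ofReal
    (|mmon β x| / (b ^ mlen (α + β) * mfact α ^ σ * mfact β ^ σ) * ‖mderiv α φ x‖)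

/-- The Gelfand-Shilov space `𝒮^{(σ)}(ℝⁿ)`. -/
def IsGelfandShilov {n : ℕ} (σ : ℝ) (φ : Rn n → ℂ) : Prop :=
  ContDiff ℝ ∞ φ ∧ ∀ b : ℝ, 0 < b → gsNorm b σ φ < ⊤

/-- `φ ∈ 𝒮^{(σ)}(ℝⁿ)` is a mollifier: `∫ φ = 1` and `∫ x^α φ(x) dx = 0` for all `α ≠ 0`. -/
def IsMollifier {n : ℕ} (σ : ℝ) (φ : Rn n → ℂ) : Prop :=
  IsGelfandShilov σ φ ∧ ∫ x, φ x = 1 ∧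
    ∀ α : Fin n → ℕ, α ≠ 0 → ∫ x, (mmon α x : ℂ) * φ x = 0

/-- `χ ∈ γ^σ(ℝⁿ)` is a cut-off function: `0 ≤ χ ≤ 1`, `χ = 0` for `|x| ≥ 2`, and `χ = 1` for
`|x| ≤ 1`. -/
def IsCutoff {n : ℕ} (σ : ℝ) (χ : Rn n → ℝ) : Prop :=
  IsGevrey σ χ ∧ (∀ x, 0 ≤ χ x ∧ χ x ≤ 1) ∧ (∀ x, 2 ≤ ‖x‖ → χ x = 0) ∧
    ∀ x, ‖x‖ ≤ 1 → χ x = 1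

/-- The net `ρ_ε(x) = ε^{-n} φ(x/ε) χ(x |log ε|)`. -/
def rho {n : ℕ} (φ : Rn n → ℂ) (χ : Rn n → ℝ) (ε : ℝ) (x : Rn n) : ℂ :=
  ((ε ^ n)⁻¹ : ℝ) * φ (ε⁻¹ • x) * (χ (|Real.log ε| • x) : ℂ)

/-- The test function `y ↦ A (f (x - y))`, where `f` is smooth with compact support and `A : ℂ → ℝ`
is real linear (the real or the imaginary part). -/
def reflTest {n : ℕ} (A : ℂ →L[ℝ] ℝ) (f : Rn n → ℂ) (hf : ContDiff ℝ ∞ f)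
    (hc : HasCompactSupport f) (x : Rn n) : 𝓓((⊤ : TopologicalSpace.Opens (Rn n)), ℝ) where
  toFun y := A (f (x - y))
  contDiff' := A.contDiff.comp (hf.comp (contDiff_const.sub contDiff_id))
  hasCompactSupport' :=
    (hc.comp_homeomorph (Homeomorph.subLeft x)).comp_left (g := A) (map_zero A)
  tsupport_subset' := fun _ _ => trivial

open Classical in
/-- The convolution `(u ∗ f)(x) = ⟨u_y, f(x - y)⟩` of a distribution `u` on `ℝⁿ` with a smooth
compactly supported function `f : ℝⁿ → ℂ`. A complex valued distribution is given by its values on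
real valued test functions; its value on `g : ℝⁿ → ℂ` is `u (Re g) + i u (Im g)`. For a function `f`
that is not a test function, the value `0` is a placeholder. -/
def distConv {n : ℕ} (u : 𝓓'((⊤ : TopologicalSpace.Opens (Rn n)), ℂ)) (f : Rn n → ℂ)
    (x : Rn n) : ℂ :=
  if h : ContDiff ℝ ∞ f ∧ HasCompactSupport f then
    u (reflTest Complex.reCLM f h.1 h.2 x) + Complex.I * u (reflTest Complex.imCLM f h.1 h.2 x)
  else 0

/-- For `0 < ε < 1` the function `ρ_ε` is smooth with compact support, so that `u ∗ ρ_ε` is given by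
the first case in the definition of the convolution. -/
theorem rho_test {n : ℕ} {σ : ℝ} {φ : Rn n → ℂ} {χ : Rn n → ℝ} (hφ : IsMollifier σ φ)
    (hχ : IsCutoff σ χ) {ε : ℝ} (hε : ε ∈ Set.Ioo (0 : ℝ) 1) :
    ContDiff ℝ ∞ (rho φ χ ε) ∧ HasCompactSupport (rho φ χ ε) := by
  have hl : 0 < |Real.log ε| := abs_pos.2 (Real.log_neg hε.1 hε.2).ne
  constructor
  · have h1 : ContDiff ℝ ∞ (fun x : Rn n => φ (ε⁻¹ • x)) :=
      hφ.1.1.comp (contDiff_id.const_smul (ε⁻¹))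
    have h2 : ContDiff ℝ ∞ (fun x : Rn n => (χ (|Real.log ε| • x) : ℂ)) :=
      Complex.ofRealCLM.contDiff.comp (hχ.1.1.comp (contDiff_id.const_smul (|Real.log ε|)))
    exact (contDiff_const.mul h1).mul h2
  · refine HasCompactSupport.intro (isCompact_closedBall (0 : Rn n) (2 / |Real.log ε|)) ?_
    intro x hx
    have hx' : 2 / |Real.log ε| < ‖x‖ := by simpa using hx
    have h2 : 2 ≤ ‖|Real.log ε| • x‖ := by
      rw [norm_smul, Real.norm_eq_abs, abs_abs, mul_comm]
      exact ((div_lt_iff₀ hl).1 hx').le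
    simp [rho, hχ.2.2.1 _ h2]

/-- The Fourier transform `f̂(ξ) = ∫ e^{-i x·ξ} f(x) dx`, that is, Mathlib's Fourier transform
`∫ e^{-2πi x·η} f(x) dx` at `η = ξ / (2π)`. -/
def hat {n : ℕ} (f : Rn n → ℂ) (ξ : Rn n) : ℂ :=
  𝓕 f ((2 * Real.pi)⁻¹ • ξ)

theorem hat_eq {n : ℕ} (f : Rn n → ℂ) (ξ : Rn n) :
    hat f ξ = ∫ x : Rn n, Complex.exp (-(Complex.I * (inner ℝ x ξ : ℝ))) * f x := by
  rw [hat, Real.fourier_eq']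
  refine MeasureTheory.integral_congr_ae (Filter.Eventually.of_forall fun x => ?_)
  have hpi : (Real.pi : ℂ) ≠ 0 := by exact_mod_cast Real.pi_ne_zero
  simp only [inner_smul_right, smul_eq_mul]
  congr 2
  push_cast
  field_simp

/-- The Japanese bracket `⟨ξ⟩ = (1 + |ξ|²)^{1/2}`. -/
def jap {n : ℕ} (ξ : Rn n) : ℝ := Real.sqrt (1 + ‖ξ‖ ^ 2)

end GevreyReg

end

/-! All estimates are made for the operator norm of the full `k`-th derivative, with weights `M B^k
(k!)^σ`. In this form they behave well under dilations, products and shifts of `k`. Passing to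
multi-indices and back costs only geometric factors, because `α! ≤ |α|! ≤ n^|α| α!`.

The Gelfand-Shilov condition bounds the derivatives of `φ` in `L¹`, and a Sobolev inequality
(Fourier inversion) makes these sup bounds. The cutoff has such bounds because it is Gevrey on a
ball and zero outside. In the Leibniz rule for `ρ_ε` each derivative costs `ε⁻¹` on `φ(x/ε)` and
`|log ε| ≤ ε⁻¹` on the cutoff, so the `k`-th derivative is at most `M B^k (k!)^σ ε^{-n-k}`
(`norm_iteratedFDeriv_rho_le`).

On a fixed compact set `u` has some finite order `m`. Since `∂(u ∗ f) = u ∗ ∂f`, the `k`-th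
derivative of `u ∗ ρ_ε` is controlled by at most `k + m` derivatives of `ρ_ε`; the extra `m` only
change the constants and the power of `ε` (`exists_norm_iteratedFDeriv_distConv_rho_le`). The
supports stay in one ball, so the bounds are global and give (b) and (c).

For (d), integrating over that ball gives `(ε|ξ|)^k |f̂(ξ)| ≤ P D^k (k!)^σ` for every `k`, where `P`
carries a fixed power of `ε⁻¹`. Taking `1/σ`-th powers and summing an exponential series turns this
into decay in `(ε|ξ|)^{1/σ}` (`le_exp_of_pow_mul_le`). -/

namespace GevreyReg

/-! ### Iterated directional derivatives -/

section ListDeriv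

variable {E F : Type*} [NormedAddCommGroup E] [NormedSpace ℝ E] [NormedAddCommGroup F]
  [NormedSpace ℝ F]

/-- The iterated directional derivative of `f` along the vectors of a list. -/
noncomputable def listDeriv (L : List E) (f : E → F) : E → F :=
  L.foldr (fun v g x => fderiv ℝ g x v) f

@[simp]
theorem listDeriv_nil (f : E → F) : listDeriv [] f = f := rfl

theorem listDeriv_cons (v : E) (L : List E) (f : E → F) :
    listDeriv (v :: L) f = fun x => fderiv ℝ (listDeriv L f) x v := rfl

theorem contDiff_fderiv_apply_const {f : E → F} (hf : ContDiff ℝ ∞ f) (v : E) :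
    ContDiff ℝ ∞ fun x => fderiv ℝ f x v :=
  (hf.fderiv_right (m := ∞) (by simp)).clm_apply contDiff_const

theorem contDiff_listDeriv (L : List E) {f : E → F} (hf : ContDiff ℝ ∞ f) :
    ContDiff ℝ ∞ (listDeriv L f) := by
  induction L with
  | nil => exact hf
  | cons v L ih => exact contDiff_fderiv_apply_const ih v

theorem fderiv_fderiv_apply {f : E → F} (hf : ContDiff ℝ ∞ f) (v w x : E) :
    fderiv ℝ (fun y => fderiv ℝ f y v) x w = fderiv ℝ (fderiv ℝ f) x w v := by
  have hd : DifferentiableAt ℝ (fderiv ℝ f) x :=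
    ((hf.fderiv_right (m := ∞) (by simp)).differentiable (by simp)) x
  rw [fderiv_clm_apply hd (differentiableAt_const v)]
  simp

theorem fderiv_fderiv_comm {f : E → F} (hf : ContDiff ℝ ∞ f) (v w x : E) :
    fderiv ℝ (fderiv ℝ f) x v w = fderiv ℝ (fderiv ℝ f) x w v :=
  (hf.contDiffAt (x := x)).isSymmSndFDerivAt
    (by rw [minSmoothness_of_isRCLikeNormedField]; exact WithTop.coe_le_coe.2 le_top) v w

theorem listDeriv_perm {L L' : List E} (h : L.Perm L') {f : E → F} (hf : ContDiff ℝ ∞ f) :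
    listDeriv L f = listDeriv L' f := by
  induction h with
  | nil => rfl
  | cons v _ ih => rw [listDeriv_cons, listDeriv_cons, ih]
  | swap v w L =>
    ext x
    have hL := contDiff_listDeriv L hf
    simp only [listDeriv_cons]
    rw [fderiv_fderiv_apply hL, fderiv_fderiv_apply hL, fderiv_fderiv_comm hL]
  | trans _ _ ih1 ih2 => exact ih1.trans ih2

theorem iteratedFDeriv_apply_eq_listDeriv {f : E → F} (hf : ContDiff ℝ ∞ f) :
    ∀ (k : ℕ) (v : Fin k → E) (x : E), iteratedFDeriv ℝ k f x v = listDeriv (List.ofFn v) f x := by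
  intro k
  induction k with
  | zero => intro v x; simp
  | succ k ih =>
    intro v x
    rw [iteratedFDeriv_succ_apply_left, List.ofFn_succ, listDeriv_cons]
    have h : listDeriv (List.ofFn fun i => v i.succ) f
        = fun y => iteratedFDeriv ℝ k f y (Fin.tail v) := by
      ext y; rw [ih]; rfl
    rw [h]
    have hd : DifferentiableAt ℝ (iteratedFDeriv ℝ k f) x :=
      (hf.differentiable_iteratedFDeriv (WithTop.coe_lt_coe.2 (ENat.natCast_lt_top k))) x
    exact (fderiv_continuousMultilinear_apply_const_apply hd _ _).symm

theorem norm_iteratedFDeriv_fderiv_apply_le {f : E → F} (hf : ContDiff ℝ ∞ f) (v x : E) (q : ℕ) :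
    ‖iteratedFDeriv ℝ q (fun y => fderiv ℝ f y v) x‖
      ≤ ‖v‖ * ‖iteratedFDeriv ℝ (q + 1) f x‖ := by
  rw [← norm_iteratedFDeriv_fderiv]
  exact norm_iteratedFDeriv_clm_apply_const
    (hf.fderiv_right (m := ∞) (by simp)).contDiffAt (WithTop.coe_le_coe.2 le_top)

/-- This lets an estimate for functions become one for `k`-th derivatives: apply it to `listDeriv L
f` with `L` of length `k`. The product of the norms is the one required by `opNorm_le_bound`. -/
theorem norm_iteratedFDeriv_listDeriv_le {f : E → F} (hf : ContDiff ℝ ∞ f) (L : List E) (x : E) :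
    ∀ q : ℕ, ‖iteratedFDeriv ℝ q (listDeriv L f) x‖
      ≤ (L.map norm).prod * ‖iteratedFDeriv ℝ (q + L.length) f x‖ := by
  induction L with
  | nil => intro q; simp
  | cons v L ih =>
    intro q
    rw [listDeriv_cons]
    refine (norm_iteratedFDeriv_fderiv_apply_le (contDiff_listDeriv L hf) v x q).trans ?_
    rw [List.map_cons, List.prod_cons, mul_assoc, List.length_cons, ← add_assoc, add_right_comm]
    exact mul_le_mul_of_nonneg_left (ih (q + 1)) (norm_nonneg _)

theorem support_listDeriv_subset {f : E → F} {K : Set E} (hK : IsClosed K)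
    (hf : Function.support f ⊆ K) (L : List E) : Function.support (listDeriv L f) ⊆ K := by
  induction L with
  | nil => exact hf
  | cons v L ih =>
    have h1 : tsupport (listDeriv L f) ⊆ K := closure_minimal ih hK
    exact subset_closure.trans ((tsupport_fderiv_apply_subset ℝ v).trans h1)

end ListDeriv

/-! ### Multi-indices versus full derivatives -/

section MultiIndex

variable {n : ℕ} {F : Type*} [NormedAddCommGroup F] [NormedSpace ℝ F]

theorem norm_mderiv_le (α : Fin n → ℕ) (f : Rn n → F) (x : Rn n) :
    ‖mderiv α f x‖ ≤ ‖iteratedFDeriv ℝ (mlen α) f x‖ := by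
  refine (ContinuousMultilinearMap.le_opNorm _ _).trans ?_
  simp only [PiLp.norm_single, norm_one, Finset.prod_const_one, mul_one]
  exact le_rfl

/-- The multi-index counting how often each coordinate is taken by `s`. -/
def fiberCount {k : ℕ} (s : Fin k → Fin n) (i : Fin n) : ℕ := Fintype.card {j // s j = i}

theorem mlen_fiberCount {k : ℕ} (s : Fin k → Fin n) : mlen (fiberCount s) = k := by
  have h := Fintype.card_congr (Equiv.sigmaFiberEquiv s)
  simpa [mlen, fiberCount, Fintype.card_sigma] using h

theorem ofFn_perm_of_equiv {A : Type*} {m k : ℕ} (e : Fin m ≃ Fin k) (s : Fin k → A)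
    (t : Fin m → A) (h : ∀ j, s (e j) = t j) : (List.ofFn t).Perm (List.ofFn s) := by
  obtain rfl : m = k := by simpa using Fintype.card_congr e
  have : t = s ∘ e := funext fun j => (h j).symm
  rw [this]
  exact Equiv.Perm.ofFn_comp_perm e s

/-- By symmetry of the derivatives only the multiplicity of each basis vector matters; grouping the
positions by their value under `s` gives the permutation that sorts them. -/
theorem iteratedFDeriv_single_eq_mderiv {f : Rn n → F} (hf : ContDiff ℝ ∞ f) {k : ℕ}
    (s : Fin k → Fin n) (x : Rn n) :
    iteratedFDeriv ℝ k f x (fun j => EuclideanSpace.single (s j) (1 : ℝ))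
      = mderiv (fiberCount s) f x := by
  rw [mderiv, iteratedFDeriv_apply_eq_listDeriv hf, iteratedFDeriv_apply_eq_listDeriv hf]
  refine congrFun (listDeriv_perm (List.Perm.symm ?_) hf) x
  let e : Fin (∑ i, fiberCount s i) ≃ Fin k :=
    (finSigmaFinEquiv.symm.trans
      (Equiv.sigmaCongrRight fun i => (Fintype.equivFin {j // s j = i}).symm)).trans
      (Equiv.sigmaFiberEquiv s)
  refine ofFn_perm_of_equiv e _ _ fun j => ?_
  have : s (e j) = (finSigmaFinEquiv.symm j).1 :=
    ((Fintype.equivFin {j' // s j' = (finSigmaFinEquiv.symm j).1}).symm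
      (finSigmaFinEquiv.symm j).2).2
  rw [this]

theorem norm_iteratedFDeriv_le_sum_mderiv {f : Rn n → F} (hf : ContDiff ℝ ∞ f) (k : ℕ)
    (x : Rn n) :
    ‖iteratedFDeriv ℝ k f x‖ ≤ ∑ s : Fin k → Fin n, ‖mderiv (fiberCount s) f x‖ := by
  refine ContinuousMultilinearMap.opNorm_le_bound (by positivity) fun v => ?_
  have hv : v = fun j => ∑ i, v j i • EuclideanSpace.single i (1 : ℝ) := by
    ext j i
    simp [Pi.single_apply]
  conv_lhs => rw [hv]
  rw [← ContinuousMultilinearMap.coe_coe, MultilinearMap.map_sum, Finset.sum_mul]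
  refine (norm_sum_le _ _).trans (Finset.sum_le_sum fun s _ => ?_)
  rw [MultilinearMap.map_smul_univ, norm_smul, ContinuousMultilinearMap.coe_coe,
    iteratedFDeriv_single_eq_mderiv hf, mul_comm]
  refine mul_le_mul_of_nonneg_left ?_ (norm_nonneg _)
  rw [norm_prod]
  exact Finset.prod_le_prod (fun _ _ => norm_nonneg _) fun j _ => PiLp.norm_apply_le (v j) (s j)

theorem one_le_mfact (α : Fin n → ℕ) : 1 ≤ mfact α :=
  Finset.one_le_prod fun i _ => by exact_mod_cast (α i).factorial_pos

theorem mfact_le_factorial (α : Fin n → ℕ) : mfact α ≤ (mlen α).factorial := by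
  have h := Nat.le_of_dvd (Nat.factorial_pos _)
    (Nat.prod_factorial_dvd_factorial_sum Finset.univ α)
  unfold mfact mlen
  exact_mod_cast h

/-- The multinomial coefficients of degree `k` add up to `n^k`, by the multinomial theorem with all
variables equal to `1`, so each of them is at most `n^k`. -/
theorem factorial_le_pow_mul_mfact (α : Fin n → ℕ) :
    ((mlen α).factorial : ℝ) ≤ (n : ℝ) ^ mlen α * mfact α := by
  have h1 : Nat.multinomial Finset.univ α ≤ n ^ mlen α := by
    have h := Finset.sum_pow_eq_sum_piAntidiag (R := ℕ) (Finset.univ : Finset (Fin n))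
      (fun _ => 1) (mlen α)
    simp only [Finset.sum_const, Finset.card_univ, Fintype.card_fin, smul_eq_mul, mul_one,
      one_pow, Finset.prod_const_one, Nat.cast_id] at h
    rw [h]
    exact Finset.single_le_sum (f := fun k => Nat.multinomial Finset.univ k)
      (fun _ _ => Nat.zero_le _) (by simp [mlen])
  have h2 : (mlen α).factorial ≤ n ^ mlen α * ∏ i, (α i).factorial := by
    rw [mlen, ← Nat.multinomial_spec Finset.univ α, mul_comm]
    exact Nat.mul_le_mul_right _ h1
  unfold mfact
  exact_mod_cast h2

end MultiIndex

/-! ### Gevrey weights -/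

section Factorial

/-- The Gevrey weight `(k!)^σ`. -/
noncomputable def gevreyWeight (σ : ℝ) (k : ℕ) : ℝ := (k.factorial : ℝ) ^ σ

variable {σ : ℝ}

theorem one_le_gevreyWeight (hσ : 0 ≤ σ) (k : ℕ) : 1 ≤ gevreyWeight σ k :=
  Real.one_le_rpow (by exact_mod_cast k.factorial_pos) hσ

theorem gevreyWeight_mono (hσ : 0 ≤ σ) {k m : ℕ} (h : k ≤ m) : gevreyWeight σ k ≤ gevreyWeight σ m :=
  Real.rpow_le_rpow (by positivity) (by exact_mod_cast Nat.factorial_le h) hσ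

theorem gevreyWeight_mul_le (hσ : 0 ≤ σ) {i k : ℕ} (h : i ≤ k) :
    gevreyWeight σ i * gevreyWeight σ (k - i) ≤ gevreyWeight σ k := by
  rw [gevreyWeight, gevreyWeight, ← Real.mul_rpow (by positivity) (by positivity)]
  refine Real.rpow_le_rpow (by positivity) ?_ hσ
  exact_mod_cast Nat.le_of_dvd k.factorial_pos (Nat.factorial_mul_factorial_dvd_factorial h)

theorem gevreyWeight_add_le (hσ : 0 ≤ σ) (k m : ℕ) :
    gevreyWeight σ (k + m) ≤ ((2 : ℝ) ^ σ) ^ (k + m) * (gevreyWeight σ k * gevreyWeight σ m) := by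
  rw [gevreyWeight, gevreyWeight, gevreyWeight, ← Real.mul_rpow (by positivity) (by positivity),
    ← Real.rpow_natCast, ← Real.rpow_mul (by positivity), mul_comm σ, Real.rpow_mul (by positivity),
    Real.rpow_natCast, ← Real.mul_rpow (by positivity) (by positivity)]
  refine Real.rpow_le_rpow (by positivity) ?_ hσ
  have h : (k + m).factorial ≤ 2 ^ (k + m) * (k.factorial * m.factorial) := by
    rw [← Nat.add_choose_mul_factorial_mul_factorial k m, mul_assoc]
    exact Nat.mul_le_mul_right _ (Nat.choose_le_two_pow _ _)
  exact_mod_cast h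

/-- A shift of the order of differentiation costs only constants. -/
theorem exists_bound_shift (hσ : 0 ≤ σ) {M B : ℝ} (hM : 1 ≤ M) (hB : 1 ≤ B) (m : ℕ) :
    ∃ M' B' : ℝ, 1 ≤ M' ∧ 1 ≤ B' ∧ ∀ k j : ℕ, j ≤ m →
      M * B ^ (k + j) * gevreyWeight σ (k + j) ≤ M' * B' ^ k * gevreyWeight σ k := by
  have h2 : (1 : ℝ) ≤ 2 ^ σ := Real.one_le_rpow (by norm_num) hσ
  have hD : 1 ≤ B * 2 ^ σ := one_le_mul_of_one_le_of_one_le hB h2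
  have hw := one_le_gevreyWeight hσ m
  refine ⟨M * (B * 2 ^ σ) ^ m * gevreyWeight σ m, B * 2 ^ σ, ?_, hD, fun k j hj => ?_⟩
  · exact one_le_mul_of_one_le_of_one_le
      (one_le_mul_of_one_le_of_one_le hM (one_le_pow₀ hD)) hw
  have hk := one_le_gevreyWeight hσ k
  calc M * B ^ (k + j) * gevreyWeight σ (k + j)
      ≤ M * B ^ (k + m) * gevreyWeight σ (k + m) := by
        have h1 := gevreyWeight_mono hσ (Nat.add_le_add_left hj k)
        have h0 := zero_le_one.trans (one_le_gevreyWeight hσ (k + j))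
        gcongr
    _ ≤ M * B ^ (k + m) * (((2 : ℝ) ^ σ) ^ (k + m) * (gevreyWeight σ k * gevreyWeight σ m)) := by
        gcongr
        exact gevreyWeight_add_le hσ k m
    _ = _ := by rw [pow_add, pow_add, mul_pow, mul_pow]; ring

end Factorial

end GevreyReg

namespace GevreyReg

/-! ### Fourier transform and Sobolev inequality -/

section Fourier

open MeasureTheory

variable {V : Type*} [NormedAddCommGroup V] [InnerProductSpace ℝ V] [FiniteDimensional ℝ V]
  [MeasurableSpace V] [BorelSpace V]

theorem pow_mul_norm_fourier_le {g : V → ℂ} (hg : ContDiff ℝ ∞ g) {m : ℕ}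
    (hi : ∀ q ≤ m, Integrable (iteratedFDeriv ℝ q g)) (w : V) :
    ‖w‖ ^ m * ‖𝓕 g w‖
      ≤ 2 ^ m * ∑ q ∈ Finset.range (m + 1), ∫ v, ‖iteratedFDeriv ℝ q g v‖ := by
  have h := Real.pow_mul_norm_iteratedFDeriv_fourier_le (K := 0) (N := (m : ℕ∞))
    (hg.of_le (WithTop.coe_le_coe.2 le_top)) (fun k q hk hq => by
      obtain rfl : k = 0 := by simpa using hk
      simpa using (hi q (by exact_mod_cast hq)).norm) (k := 0) (n := m) le_rfl le_rfl w
  simpa [Finset.sum_product] using h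

/-- A Sobolev inequality: the sup norm is controlled by the `L¹` norms of the derivatives. -/
theorem exists_norm_le_sum_integral_iteratedFDeriv (V : Type*) [NormedAddCommGroup V]
    [InnerProductSpace ℝ V] [FiniteDimensional ℝ V] [MeasurableSpace V] [BorelSpace V] :
    ∃ C : ℝ, 0 ≤ C ∧ ∀ g : V → ℂ, ContDiff ℝ ∞ g →
      (∀ q ≤ Module.finrank ℝ V + 1, Integrable (iteratedFDeriv ℝ q g)) → ∀ x,
        ‖g x‖ ≤ C * ∑ q ∈ Finset.range (Module.finrank ℝ V + 2),
          ∫ v, ‖iteratedFDeriv ℝ q g v‖ := by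
  -- One more than the dimension, so that `(1 + ‖w‖)^(-m)` is integrable.
  set m := Module.finrank ℝ V + 1 with hm
  have hJ : Integrable (fun w : V => (1 + ‖w‖) ^ (-(m : ℝ))) :=
    integrable_one_add_norm (by rw [hm]; push_cast; linarith)
  refine ⟨2 ^ m * (1 + 2 ^ m) * ∫ w : V, (1 + ‖w‖) ^ (-(m : ℝ)), ?_, fun g hg hi x => ?_⟩
  · refine mul_nonneg (by positivity) (integral_nonneg fun w => by positivity)
  set S := ∑ q ∈ Finset.range (m + 1), ∫ v, ‖iteratedFDeriv ℝ q g v‖ with hS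
  have hgi : Integrable g := by
    have h := (hi 0 (Nat.zero_le _)).norm
    simp only [norm_iteratedFDeriv_zero] at h
    exact (integrable_norm_iff hg.continuous.aestronglyMeasurable).1 h
  have hterm : ∀ q ∈ Finset.range (m + 1), 0 ≤ ∫ v, ‖iteratedFDeriv ℝ q g v‖ :=
    fun q _ => integral_nonneg fun v => norm_nonneg _
  have h0 : ∀ w : V, ‖𝓕 g w‖ ≤ S := fun w => by
    have h := pow_mul_norm_fourier_le hg (m := 0) (fun q hq => hi q (by omega)) w
    simp only [pow_zero, one_mul] at h
    refine h.trans (Finset.sum_le_sum_of_subset_of_nonneg ?_ fun q hq _ => hterm q hq)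
    exact Finset.range_subset_range.2 (by omega)
  have h1 : ∀ w : V, ‖w‖ ^ m * ‖𝓕 g w‖ ≤ 2 ^ m * S := pow_mul_norm_fourier_le hg hi
  have hbound : ∀ w : V, ‖𝓕 g w‖ ≤ 2 ^ m * (1 + 2 ^ m) * S * (1 + ‖w‖) ^ (-(m : ℝ)) := fun w => by
    rw [Real.rpow_neg (by positivity), Real.rpow_natCast, ← div_eq_mul_inv,
      le_div_iff₀ (by positivity)]
    have h2 : (1 + ‖w‖) ^ m ≤ 2 ^ m * (1 + ‖w‖ ^ m) := by
      have h3 : (1 + ‖w‖) ^ m ≤ (2 * max 1 ‖w‖) ^ m := by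
        gcongr
        linarith [le_max_left 1 ‖w‖, le_max_right 1 ‖w‖]
      rw [mul_pow] at h3
      refine h3.trans ?_
      gcongr
      rcases max_cases 1 ‖w‖ with ⟨h, _⟩ | ⟨h, _⟩ <;> rw [h]
      · simp
      · linarith
    calc ‖𝓕 g w‖ * (1 + ‖w‖) ^ m ≤ ‖𝓕 g w‖ * (2 ^ m * (1 + ‖w‖ ^ m)) := by gcongr
      _ = 2 ^ m * (‖𝓕 g w‖ + ‖w‖ ^ m * ‖𝓕 g w‖) := by ring
      _ ≤ 2 ^ m * (S + 2 ^ m * S) :=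
          mul_le_mul_of_nonneg_left (add_le_add (h0 w) (h1 w)) (by positivity)
      _ = _ := by ring
  have hcont : Continuous (𝓕 g) :=
    (Real.contDiff_fourier (N := 0) (fun q hq => by
      obtain rfl : q = 0 := by simpa using hq
      simpa using hgi.norm)).continuous
  have hFi : Integrable (𝓕 g) :=
    (hJ.const_mul _).mono' hcont.aestronglyMeasurable (Filter.Eventually.of_forall hbound)
  -- By Fourier inversion the sup norm of `g` is at most the `L¹` norm of `𝓕 g`.
  have hinv := congrFun (Continuous.fourierInv_fourier_eq hg.continuous hgi hFi) x
  rw [← hinv, Real.fourierInv_eq_fourier_neg]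
  refine (VectorFourier.norm_fourierIntegral_le_integral_norm _ _ _ _ _).trans ?_
  refine (integral_mono hFi.norm (hJ.const_mul _) hbound).trans ?_
  rw [integral_const_mul]
  exact le_of_eq (by ring)

end Fourier

/-! ### Derivative bounds for the mollifier, the cutoff and `ρ_ε` -/

section Mollifier

open MeasureTheory

variable {n : ℕ} {σ : ℝ}

/-- This is the term `β = 0` of the supremum with `b = 1`. -/
theorem integrable_mderiv_of_isGelfandShilov {φ : Rn n → ℂ} (hφ : IsGelfandShilov σ φ) :
    ∃ G : ℝ, 1 ≤ G ∧ ∀ α : Fin n → ℕ, Integrable (mderiv α φ) ∧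
      ∫ x, ‖mderiv α φ x‖ ≤ G * mfact α ^ σ := by
  have hG := hφ.2 1 one_pos
  refine ⟨max 1 (gsNorm 1 σ φ).toReal, le_max_left _ _, fun α => ?_⟩
  have hpos : 0 < mfact α ^ σ := Real.rpow_pos_of_pos (one_pos.trans_le (one_le_mfact α)) _
  have h1 : ∫⁻ x : Rn n, ENNReal.ofReal ((mfact α ^ σ)⁻¹ * ‖mderiv α φ x‖) ≤ gsNorm 1 σ φ := by
    refine le_trans (le_of_eq ?_) (le_iSup₂ (f := fun (α β : Fin n → ℕ) => ∫⁻ x : Rn n,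
      ENNReal.ofReal (|mmon β x| / ((1 : ℝ) ^ mlen (α + β) * mfact α ^ σ * mfact β ^ σ)
        * ‖mderiv α φ x‖)) α 0)
    simp [mmon, mfact]
  have hc : Continuous (mderiv α φ) := by
    have h := hφ.1.continuous_iteratedFDeriv (m := ∑ i, α i) (WithTop.coe_le_coe.2 le_top)
    exact (ContinuousMultilinearMap.apply ℝ (fun _ : Fin (∑ i, α i) => Rn n) ℂ
      _).continuous.comp h
  have hint : Integrable (fun x => (mfact α ^ σ)⁻¹ * ‖mderiv α φ x‖) := by
    refine ⟨(hc.norm.const_mul _).aestronglyMeasurable, ?_⟩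
    rw [hasFiniteIntegral_iff_ofReal (Filter.Eventually.of_forall fun x => by positivity)]
    exact h1.trans_lt hG
  have hint' : Integrable (mderiv α φ) := by
    refine (integrable_norm_iff hc.aestronglyMeasurable).1 ?_
    refine (hint.const_mul (mfact α ^ σ)).congr (Filter.Eventually.of_forall fun x => ?_)
    field_simp
  refine ⟨hint', ?_⟩
  have h2 : ∫ x, (mfact α ^ σ)⁻¹ * ‖mderiv α φ x‖ ≤ (gsNorm 1 σ φ).toReal := by
    rw [integral_eq_lintegral_of_nonneg_ae (Filter.Eventually.of_forall fun x => by positivity)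
      hint.1]
    exact ENNReal.toReal_mono hG.ne h1
  rw [integral_const_mul, inv_mul_le_iff₀ hpos, mul_comm] at h2
  exact h2.trans (by gcongr; exact le_max_right _ _)

theorem integral_norm_iteratedFDeriv_le_of_isGelfandShilov (hσ : 0 ≤ σ) {φ : Rn n → ℂ}
    (hφ : IsGelfandShilov σ φ) :
    ∃ M B : ℝ, 1 ≤ M ∧ 1 ≤ B ∧ ∀ k : ℕ, Integrable (iteratedFDeriv ℝ k φ) ∧
      ∫ x, ‖iteratedFDeriv ℝ k φ x‖ ≤ M * B ^ k * gevreyWeight σ k := by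
  obtain ⟨G, hG, h⟩ := integrable_mderiv_of_isGelfandShilov hφ
  -- There are `n^k` index tuples; `n + 1` keeps the base at least `1` when `n = 0`.
  refine ⟨G, n + 1, hG, by simp, fun k => ?_⟩
  have hle := norm_iteratedFDeriv_le_sum_mderiv hφ.1 k
  have hsum : Integrable (fun x => ∑ s : Fin k → Fin n, ‖mderiv (fiberCount s) φ x‖) :=
    integrable_finsetSum _ fun s _ => (h _).1.norm
  have hc : Continuous (iteratedFDeriv ℝ k φ) :=
    hφ.1.continuous_iteratedFDeriv (WithTop.coe_le_coe.2 le_top)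
  have hint : Integrable (iteratedFDeriv ℝ k φ) :=
    hsum.mono' hc.aestronglyMeasurable (Filter.Eventually.of_forall hle)
  refine ⟨hint, (integral_mono hint.norm hsum hle).trans ?_⟩
  rw [integral_finsetSum _ fun s _ => (h _).1.norm]
  calc ∑ s : Fin k → Fin n, ∫ x, ‖mderiv (fiberCount s) φ x‖
      ≤ ∑ _s : Fin k → Fin n, G * gevreyWeight σ k := by
        refine Finset.sum_le_sum fun s _ => (h _).2.trans ?_
        have h1 := mfact_le_factorial (fiberCount s)
        rw [mlen_fiberCount] at h1
        have h0 := zero_le_one.trans (one_le_mfact (fiberCount s))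
        unfold gevreyWeight
        gcongr
    _ = G * (n : ℝ) ^ k * gevreyWeight σ k := by
        simp; ring
    _ ≤ G * ((n : ℝ) + 1) ^ k * gevreyWeight σ k := by
        have := one_le_gevreyWeight hσ k
        gcongr
        simp

/-- The Sobolev inequality is applied to the directional derivatives of order `k`; the boundedly
many additional derivatives are absorbed by `exists_bound_shift`. -/
theorem norm_iteratedFDeriv_le_of_isGelfandShilov (hσ : 0 ≤ σ) {φ : Rn n → ℂ}
    (hφ : IsGelfandShilov σ φ) :
    ∃ M B : ℝ, 1 ≤ M ∧ 1 ≤ B ∧ ∀ (k : ℕ) (x : Rn n),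
      ‖iteratedFDeriv ℝ k φ x‖ ≤ M * B ^ k * gevreyWeight σ k := by
  obtain ⟨M, B, hM, hB, h⟩ := integral_norm_iteratedFDeriv_le_of_isGelfandShilov hσ hφ
  obtain ⟨C, hC, hS⟩ := exists_norm_le_sum_integral_iteratedFDeriv (Rn n)
  set m := Module.finrank ℝ (Rn n) + 1
  obtain ⟨M', B', hM', hB', hshift⟩ := exists_bound_shift hσ hM hB m
  have hm : (0 : ℝ) ≤ (m + 1 : ℕ) := by positivity
  refine ⟨(1 + C) * ((m + 1 : ℕ) * M'), B', ?_, hB', fun k x => ?_⟩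
  · have : (1 : ℝ) ≤ (m + 1 : ℕ) := by exact_mod_cast Nat.succ_pos m
    exact one_le_mul_of_one_le_of_one_le (by linarith) (one_le_mul_of_one_le_of_one_le this hM')
  have hw := zero_le_one.trans (one_le_gevreyWeight hσ k)
  refine ContinuousMultilinearMap.opNorm_le_bound (by positivity) fun v => ?_
  rw [iteratedFDeriv_apply_eq_listDeriv hφ.1]
  set L := List.ofFn v
  have hL : (L.map norm).prod = ∏ i, ‖v i‖ := by
    simp [L, List.map_ofFn, List.prod_ofFn]
  have hLlen : L.length = k := by simp [L]
  have hD : ∀ q y, ‖iteratedFDeriv ℝ q (listDeriv L φ) y‖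
      ≤ (∏ i, ‖v i‖) * ‖iteratedFDeriv ℝ (k + q) φ y‖ := fun q y => by
    have := norm_iteratedFDeriv_listDeriv_le hφ.1 L y q
    rwa [hL, hLlen, add_comm q k] at this
  have hLs := contDiff_listDeriv L hφ.1
  have hint : ∀ q, Integrable (iteratedFDeriv ℝ q (listDeriv L φ)) := fun q =>
    ((h (k + q)).1.norm.const_mul (∏ i, ‖v i‖)).mono'
      (hLs.continuous_iteratedFDeriv (WithTop.coe_le_coe.2 le_top)).aestronglyMeasurable
      (Filter.Eventually.of_forall (hD q))
  have hP : 0 ≤ ∏ i, ‖v i‖ := Finset.prod_nonneg fun _ _ => norm_nonneg _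
  have hbd : ∀ q ∈ Finset.range (m + 1), ∫ y, ‖iteratedFDeriv ℝ q (listDeriv L φ) y‖
      ≤ (∏ i, ‖v i‖) * (M' * B' ^ k * gevreyWeight σ k) := fun q hq => by
    refine (integral_mono (hint q).norm ((h (k + q)).1.norm.const_mul _) (hD q)).trans ?_
    rw [integral_const_mul]
    exact mul_le_mul_of_nonneg_left ((h (k + q)).2.trans
      (hshift k q (Nat.lt_succ_iff.1 (Finset.mem_range.1 hq)))) hP
  refine (hS _ hLs (fun q _ => hint q) x).trans ?_
  calc C * ∑ q ∈ Finset.range (m + 1), ∫ y, ‖iteratedFDeriv ℝ q (listDeriv L φ) y‖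
      ≤ C * ∑ _q ∈ Finset.range (m + 1), (∏ i, ‖v i‖) * (M' * B' ^ k * gevreyWeight σ k) := by
        gcongr with q hq
        exact hbd q hq
    _ = C * (((m + 1 : ℕ) * M') * B' ^ k * gevreyWeight σ k * ∏ i, ‖v i‖) := by
        rw [Finset.sum_const, Finset.card_range, nsmul_eq_mul]; ring
    _ ≤ (1 + C) * (((m + 1 : ℕ) * M') * B' ^ k * gevreyWeight σ k * ∏ i, ‖v i‖) := by
        gcongr
        linarith
    _ = _ := by ring

theorem norm_iteratedFDeriv_le_of_isCutoff (hσ : 0 ≤ σ) {χ : Rn n → ℝ} (hχ : IsCutoff σ χ) :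
    ∃ M B : ℝ, 1 ≤ M ∧ 1 ≤ B ∧ ∀ (k : ℕ) (x : Rn n),
      ‖iteratedFDeriv ℝ k χ x‖ ≤ M * B ^ k * gevreyWeight σ k := by
  obtain ⟨C, hC, h⟩ := hχ.1.2 (Metric.closedBall 0 2) (isCompact_closedBall _ _)
  refine ⟨1 + C, (n + 1) * (1 + C), by linarith, ?_, fun k x => ?_⟩
  · exact one_le_mul_of_one_le_of_one_le (by simp) (by linarith)
  have hw := one_le_gevreyWeight hσ k
  by_cases hx : x ∈ Metric.closedBall (0 : Rn n) 2
  · refine (norm_iteratedFDeriv_le_sum_mderiv hχ.1.1 k x).trans ?_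
    calc ∑ s : Fin k → Fin n, ‖mderiv (fiberCount s) χ x‖
        ≤ ∑ _s : Fin k → Fin n, C ^ (k + 1) * gevreyWeight σ k := by
          refine Finset.sum_le_sum fun s _ => (h (fiberCount s) x hx).trans ?_
          have h1 := mfact_le_factorial (fiberCount s)
          rw [mlen_fiberCount] at h1 ⊢
          have h0 := zero_le_one.trans (one_le_mfact (fiberCount s))
          unfold gevreyWeight
          gcongr
      _ = (n : ℝ) ^ k * (C ^ (k + 1) * gevreyWeight σ k) := by simp
      _ ≤ ((n : ℝ) + 1) ^ k * ((1 + C) ^ (k + 1) * gevreyWeight σ k) := by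
          gcongr <;> linarith
      _ = _ := by rw [mul_pow]; ring
  · have hs : tsupport χ ⊆ Metric.closedBall 0 2 := by
      refine closure_minimal (fun y hy => ?_) Metric.isClosed_closedBall
      by_contra hy'
      exact hy (hχ.2.2.1 y (by simpa using (not_le.1 (fun hle => hy' (by simpa using hle))).le))
    have h0 : iteratedFDeriv ℝ k χ x = 0 := by
      by_contra hne
      exact hx (hs (support_iteratedFDeriv_subset k hne))
    rw [h0, norm_zero]
    positivity

theorem norm_iteratedFDeriv_rho_le (hσ : 0 ≤ σ) {φ : Rn n → ℂ} (hφ : IsGelfandShilov σ φ)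
    {χ : Rn n → ℝ} (hχ : IsCutoff σ χ) :
    ∃ M B : ℝ, 1 ≤ M ∧ 1 ≤ B ∧ ∀ (k : ℕ) (x : Rn n), ∀ ε ∈ Set.Ioo (0 : ℝ) 1,
      ‖iteratedFDeriv ℝ k (rho φ χ ε) x‖
        ≤ M * B ^ k * gevreyWeight σ k * (ε ^ (n + k))⁻¹ := by
  obtain ⟨M₁, B₁, hM₁, hB₁, h₁⟩ := norm_iteratedFDeriv_le_of_isGelfandShilov hσ hφ
  obtain ⟨M₂, B₂, hM₂, hB₂, h₂⟩ := norm_iteratedFDeriv_le_of_isCutoff hσ hχ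
  refine ⟨M₁ * M₂, 2 * (B₁ * B₂), one_le_mul_of_one_le_of_one_le hM₁ hM₂,
    one_le_mul_of_one_le_of_one_le one_le_two (one_le_mul_of_one_le_of_one_le hB₁ hB₂),
    fun k x ε hε => ?_⟩
  have hε0 := hε.1
  -- Hence a derivative falling on the cutoff costs no more than one falling on `φ(x/ε)`.
  have hlog : |Real.log ε| ≤ ε⁻¹ := by
    have h := (Real.abs_log_mul_self_lt ε hε.1 hε.2.le).le
    rw [abs_mul, abs_of_pos hε0] at h
    rwa [← one_div, le_div_iff₀ hε0]
  set f : Rn n → ℂ := fun y => φ (ε⁻¹ • y) with hf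
  set g : Rn n → ℂ := fun y => (χ (|Real.log ε| • y) : ℂ) with hg
  have hfs : ContDiff ℝ ∞ f := hφ.1.comp (contDiff_id.const_smul (ε⁻¹))
  have hχs : ContDiff ℝ ∞ (fun y : Rn n => χ (|Real.log ε| • y)) :=
    hχ.1.1.comp (contDiff_id.const_smul (|Real.log ε|))
  have hgs : ContDiff ℝ ∞ g := Complex.ofRealCLM.contDiff.comp hχs
  have le_inf : ∀ i : ℕ, (i : WithTop ℕ∞) ≤ ∞ := fun i => WithTop.coe_le_coe.2 le_top
  have hfb : ∀ i, ‖iteratedFDeriv ℝ i f x‖ ≤ (ε⁻¹) ^ i * (M₁ * B₁ ^ i * gevreyWeight σ i) := by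
    intro i
    rw [hf, iteratedFDeriv_comp_const_smul _ (hφ.1.of_le (le_inf i)), norm_smul, norm_pow,
      Real.norm_of_nonneg (inv_nonneg.2 hε0.le)]
    gcongr
    exact h₁ i _
  have hgb : ∀ i, ‖iteratedFDeriv ℝ i g x‖ ≤ (ε⁻¹) ^ i * (M₂ * B₂ ^ i * gevreyWeight σ i) := by
    intro i
    have h := Complex.ofRealCLM.norm_iteratedFDeriv_comp_left (hχs.contDiffAt (x := x)) (le_inf i)
    rw [Complex.ofRealCLM_norm, one_mul] at h
    refine h.trans ?_
    rw [iteratedFDeriv_comp_const_smul _ (hχ.1.1.of_le (le_inf i)), norm_smul, norm_pow,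
      Real.norm_eq_abs, abs_abs]
    gcongr
    exact h₂ i _
  have hmul : ‖iteratedFDeriv ℝ k (fun y => f y * g y) x‖
      ≤ M₁ * M₂ * (2 * (B₁ * B₂)) ^ k * gevreyWeight σ k * (ε⁻¹) ^ k := by
    refine (norm_iteratedFDeriv_mul_le hfs hgs x (le_inf k)).trans ?_
    calc ∑ i ∈ Finset.range (k + 1), (k.choose i : ℝ) * ‖iteratedFDeriv ℝ i f x‖
          * ‖iteratedFDeriv ℝ (k - i) g x‖
        ≤ ∑ i ∈ Finset.range (k + 1), (k.choose i : ℝ)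
          * (M₁ * M₂ * (B₁ * B₂) ^ k * gevreyWeight σ k * (ε⁻¹) ^ k) := by
          refine Finset.sum_le_sum fun i hi => ?_
          have hik : i ≤ k := Nat.lt_succ_iff.1 (Finset.mem_range.1 hi)
          rw [mul_assoc]
          refine mul_le_mul_of_nonneg_left ?_ (Nat.cast_nonneg _)
          have hwi := zero_le_one.trans (one_le_gevreyWeight hσ i)
          have hwk := zero_le_one.trans (one_le_gevreyWeight hσ k)
          have hwj := zero_le_one.trans (one_le_gevreyWeight hσ (k - i))
          calc ‖iteratedFDeriv ℝ i f x‖ * ‖iteratedFDeriv ℝ (k - i) g x‖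
              ≤ ((ε⁻¹) ^ i * (M₁ * B₁ ^ i * gevreyWeight σ i))
                * ((ε⁻¹) ^ (k - i) * (M₂ * B₂ ^ (k - i) * gevreyWeight σ (k - i))) := by
                gcongr
                exacts [hfb i, hgb (k - i)]
            _ = M₁ * M₂ * (B₁ ^ i * B₂ ^ (k - i)) * (gevreyWeight σ i * gevreyWeight σ (k - i))
                * (ε⁻¹) ^ k := by
                rw [← Nat.add_sub_cancel' hik, pow_add, Nat.add_sub_cancel_left]; ring
            _ ≤ _ := by
                rw [mul_pow]
                gcongr
                · omega
                · exact gevreyWeight_mul_le hσ hik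
      _ = _ := by
          rw [← Finset.sum_mul, ← Nat.cast_sum, Nat.sum_range_choose, mul_pow 2]
          push_cast
          ring
  have hrho : rho φ χ ε = ((ε ^ n)⁻¹ : ℝ) • fun y => f y * g y := by
    ext y
    simp [rho, hf, hg, mul_assoc]
  rw [hrho, iteratedFDeriv_const_smul_apply ((hfs.mul hgs).of_le (le_inf k)).contDiffAt, norm_smul,
    Real.norm_of_nonneg (by positivity)]
  refine (mul_le_mul_of_nonneg_left hmul (by positivity)).trans (le_of_eq ?_)
  rw [pow_add, mul_inv, inv_pow]
  ring

end Mollifier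

end GevreyReg

namespace GevreyReg

/-! ### Finite order and support of distributions -/

section TestFunction

open TopologicalSpace

variable {n : ℕ}

/-- A distribution has finite order on each compact set. -/
theorem exists_bound_of_support_subset (u : 𝓓'((⊤ : Opens (Rn n)), ℂ)) (K : Compacts (Rn n)) :
    ∃ C : ℝ, 0 ≤ C ∧ ∃ m : ℕ, ∀ (g : 𝓓((⊤ : Opens (Rn n)), ℝ)) (B : ℝ), 0 ≤ B →
      Function.support g ⊆ K → (∀ i ≤ m, ∀ x, ‖iteratedFDeriv ℝ i g x‖ ≤ B) → ‖u g‖ ≤ C * B := by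
  have hK : (K : Set (Rn n)) ⊆ (⊤ : Opens (Rn n)) := fun _ _ => trivial
  let T : 𝓓_{K}(Rn n, ℝ) →ₗ[ℝ] ℂ :=
    { toFun := fun f => u (TestFunction.ofSupportedInCLM ℝ hK f)
      map_add' := fun f g => by rw [map_add, map_add]
      map_smul' := fun c f => by rw [map_smul, map_smul]; rfl }
  have hT : Continuous T :=
    (map_continuous u).comp (TestFunction.ofSupportedInCLM ℝ hK).continuous
  -- A continuous seminorm on the functions supported in `K` is dominated by finitely many of the
  -- defining seminorms; the largest index that occurs is the order `m`.
  let q : Seminorm ℝ 𝓓_{K}(Rn n, ℝ) := (normSeminorm ℝ ℂ).comp T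
  have hq : Continuous q := continuous_norm.comp hT
  obtain ⟨s, C, -, hC⟩ := Seminorm.bound_of_continuous
    (ContDiffMapSupportedIn.withSeminorms ℝ (Rn n) ℝ ⊤ K) q hq
  refine ⟨C, C.2, s.sup id, fun g B hB hg hgB => ?_⟩
  let gK : 𝓓_{K}(Rn n, ℝ) := ContDiffMapSupportedIn.of_support_subset g.contDiff hg
  have h1 : ‖u g‖ = q gK := rfl
  rw [h1]
  refine (hC gK).trans ?_
  refine mul_le_mul_of_nonneg_left (Seminorm.finset_sup_apply_le hB fun i hi => ?_) C.2
  rw [ContDiffMapSupportedIn.seminorm_top_le_iff ℝ hB]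
  exact fun x _ => hgB i (Finset.le_sup (f := id) hi) x

/-- The product of a smooth function and a test function. -/
noncomputable def smulTest (ψ : Rn n → ℝ) (hψ : ContDiff ℝ ∞ ψ)
    (g : 𝓓((⊤ : Opens (Rn n)), ℝ)) : 𝓓((⊤ : Opens (Rn n)), ℝ) where
  toFun x := ψ x * g x
  contDiff' := hψ.mul g.contDiff
  hasCompactSupport' := g.hasCompactSupport.mul_left
  tsupport_subset' := fun _ _ => trivial

/-- A distribution vanishes on the test functions supported away from its support. -/
theorem eq_zero_of_disjoint_dsupport (u : 𝓓'((⊤ : Opens (Rn n)), ℂ))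
    (g : 𝓓((⊤ : Opens (Rn n)), ℝ)) (hg : Disjoint (tsupport g) (Distribution.dsupport u)) :
    u g = 0 := by
  have hx : ∀ x : tsupport g, ∃ s : Set (Rn n), Distribution.IsVanishingOn u s ∧ IsOpen s ∧
      (x : Rn n) ∈ s := fun x =>
    (Distribution.notMem_dsupport_iff (f := u) (x : Rn n)).1 (Set.disjoint_left.1 hg x.2)
  choose U hUv hUo hUx using hx
  -- Finitely many open sets on which `u` vanishes cover the support of `g`, and a subordinate
  -- partition of unity cuts `g` into pieces that `u` kills.
  obtain ⟨t, ht⟩ := g.hasCompactSupport.isCompact.elim_finite_subcover U hUo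
    (fun x hx => Set.mem_iUnion.2 ⟨⟨x, hx⟩, hUx ⟨x, hx⟩⟩)
  obtain ⟨f, hf⟩ := SmoothPartitionOfUnity.exists_isSubordinate
    (modelWithCornersSelf ℝ (Rn n)) (isClosed_tsupport g) (fun i : t => U i) (fun i => hUo i)
    (fun x hx => by
      obtain ⟨i, hi, hxi⟩ := Set.mem_iUnion₂.1 (ht hx)
      exact Set.mem_iUnion.2 ⟨⟨i, hi⟩, hxi⟩)
  have hsum : g = ∑ i : t, smulTest (f i) (f i).contMDiff.contDiff g := by
    ext x
    have h1 : (∑ i : t, smulTest (f i) (f i).contMDiff.contDiff g) x = ∑ i : t, f i x * g x := by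
      simp only [FunLike.coe_sum, Finset.sum_apply]
      rfl
    rw [h1, ← Finset.sum_mul]
    by_cases hx : x ∈ tsupport g
    · rw [← finsum_eq_sum_of_fintype, f.sum_eq_one hx, one_mul]
    · rw [image_eq_zero_of_notMem_tsupport hx, mul_zero]
  rw [hsum, map_sum]
  refine Finset.sum_eq_zero fun i _ => hUv i _ ?_
  exact (tsupport_mul_subset_left (f := fun x => f i x) (g := g)).trans (hf i)

end TestFunction

/-! ### Convolution of a distribution with a test function -/

section Convolution

open TopologicalSpace

variable {n : ℕ}

theorem distConv_of_test (u : 𝓓'((⊤ : Opens (Rn n)), ℂ)) {f : Rn n → ℂ} (hf : ContDiff ℝ ∞ f)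
    (hc : HasCompactSupport f) (x : Rn n) :
    distConv u f x = u (reflTest Complex.reCLM f hf hc x)
      + Complex.I * u (reflTest Complex.imCLM f hf hc x) := dif_pos ⟨hf, hc⟩

theorem reflTest_apply (A : ℂ →L[ℝ] ℝ) {f : Rn n → ℂ} (hf : ContDiff ℝ ∞ f)
    (hc : HasCompactSupport f) (x y : Rn n) : reflTest A f hf hc x y = A (f (x - y)) := rfl

theorem distConv_add (u : 𝓓'((⊤ : Opens (Rn n)), ℂ)) {f g : Rn n → ℂ} (hf : ContDiff ℝ ∞ f)
    (hfc : HasCompactSupport f) (hg : ContDiff ℝ ∞ g) (hgc : HasCompactSupport g) (x : Rn n) :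
    distConv u (fun y => f y + g y) x = distConv u f x + distConv u g x := by
  have h : ∀ A : ℂ →L[ℝ] ℝ, reflTest A (fun y => f y + g y) (hf.add hg) (hfc.add hgc) x
      = reflTest A f hf hfc x + reflTest A g hg hgc x := fun A => by
    ext y; simp [reflTest_apply]
  rw [distConv_of_test u (hf.add hg) (hfc.add hgc), distConv_of_test u hf hfc,
    distConv_of_test u hg hgc, h, h, map_add, map_add]
  ring

theorem distConv_smul (u : 𝓓'((⊤ : Opens (Rn n)), ℂ)) (c : ℝ) {f : Rn n → ℂ}
    (hf : ContDiff ℝ ∞ f) (hfc : HasCompactSupport f) (x : Rn n) :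
    distConv u (fun y => c • f y) x = c • distConv u f x := by
  have hs : ContDiff ℝ ∞ fun y => c • f y := hf.const_smul c
  have hsc : HasCompactSupport fun y => c • f y :=
    hfc.comp_left (g := fun z : ℂ => c • z) (smul_zero c)
  have h : ∀ A : ℂ →L[ℝ] ℝ, reflTest A (fun y => c • f y) hs hsc x
      = c • reflTest A f hf hfc x := fun A => by
    ext y
    rw [reflTest_apply, map_smul]
    rfl
  rw [distConv_of_test u hs hsc, distConv_of_test u hf hfc, h, h, map_smul, map_smul]
  simp only [Complex.real_smul]
  ring

theorem distConv_translate (u : 𝓓'((⊤ : Opens (Rn n)), ℂ)) {f : Rn n → ℂ} (hf : ContDiff ℝ ∞ f)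
    (hfc : HasCompactSupport f) (x h : Rn n) :
    distConv u (fun y => f (y + h)) x = distConv u f (x + h) := by
  have hs : ContDiff ℝ ∞ fun y => f (y + h) := hf.comp (contDiff_id.add contDiff_const)
  have hsc : HasCompactSupport fun y => f (y + h) := hfc.comp_homeomorph (Homeomorph.addRight h)
  have key : ∀ A : ℂ →L[ℝ] ℝ, reflTest A (fun y => f (y + h)) hs hsc x
      = reflTest A f hf hfc (x + h) := fun A => by
    ext y
    rw [reflTest_apply, reflTest_apply, add_sub_right_comm]
  rw [distConv_of_test u hs hsc, distConv_of_test u hf hfc, key, key]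

theorem norm_iteratedFDeriv_reflTest_le (A : ℂ →L[ℝ] ℝ) {f : Rn n → ℂ} (hf : ContDiff ℝ ∞ f)
    (hc : HasCompactSupport f) (x y : Rn n) (i : ℕ) :
    ‖iteratedFDeriv ℝ i (reflTest A f hf hc x) y‖
      ≤ ‖A‖ * ‖iteratedFDeriv ℝ i f (x - y)‖ := by
  have h1 : (reflTest A f hf hc x : Rn n → ℝ) = A ∘ fun y => f (x - y) := rfl
  have h2 : ContDiff ℝ ∞ fun y => f (x - y) := hf.comp (contDiff_const.sub contDiff_id)
  rw [h1]
  refine (A.norm_iteratedFDeriv_comp_left h2.contDiffAt (WithTop.coe_le_coe.2 le_top)).trans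
    (le_of_eq ?_)
  have h3 : (fun y => f (x - y)) = fun y => (f ∘ LinearIsometryEquiv.neg ℝ) (y - x) := by
    ext y; simp
  rw [h3, iteratedFDeriv_comp_sub, LinearIsometryEquiv.norm_iteratedFDeriv_comp_right]
  simp

/-- `u ∗ f` is bounded by finitely many derivatives of `f`, locally uniformly. -/
theorem exists_norm_distConv_le (u : 𝓓'((⊤ : Opens (Rn n)), ℂ)) (R r : ℝ) :
    ∃ C : ℝ, 0 ≤ C ∧ ∃ m : ℕ, ∀ (f : Rn n → ℂ) (B : ℝ), ContDiff ℝ ∞ f → 0 ≤ B →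
      Function.support f ⊆ Metric.closedBall 0 r →
      (∀ i ≤ m, ∀ x, ‖iteratedFDeriv ℝ i f x‖ ≤ B) →
      ∀ x : Rn n, ‖x‖ ≤ R → ‖distConv u f x‖ ≤ C * B := by
  obtain ⟨C, hC, m, h⟩ := exists_bound_of_support_subset u
    ⟨Metric.closedBall 0 (R + r), isCompact_closedBall _ _⟩
  refine ⟨2 * C, by positivity, m, fun f B hf hB hsupp hfB x hx => ?_⟩
  have hc : HasCompactSupport f := HasCompactSupport.intro (isCompact_closedBall 0 r)
    fun y hy => by_contra fun h0 => hy (hsupp h0)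
  have key : ∀ A : ℂ →L[ℝ] ℝ, ‖A‖ = 1 → ‖u (reflTest A f hf hc x)‖ ≤ C * B := by
    intro A hA
    refine h _ B hB (fun y hy => ?_) fun i hi y => ?_
    · have h1 : f (x - y) ≠ 0 := fun h0 => hy (by rw [reflTest_apply, h0, map_zero])
      have h2 : ‖x - y‖ ≤ r := by simpa using hsupp h1
      have h3 : ‖y‖ ≤ ‖x‖ + ‖x - y‖ := by
        simpa using norm_sub_le x (x - y)
      simpa using h3.trans (add_le_add hx h2)
    · refine (norm_iteratedFDeriv_reflTest_le A hf hc x y i).trans ?_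
      rw [hA, one_mul]
      exact hfB i hi _
  rw [distConv_of_test u hf hc]
  refine (norm_add_le _ _).trans ?_
  rw [norm_mul, Complex.norm_I, one_mul]
  linarith [key _ Complex.reCLM_norm, key _ Complex.imCLM_norm]

/-- The reflected test function lives in the ball of radius `r` about `x`, which misses the ball of
radius `R` about `0`. -/
theorem distConv_eq_zero (u : 𝓓'((⊤ : Opens (Rn n)), ℂ)) {R r : ℝ}
    (hu : Distribution.dsupport u ⊆ Metric.closedBall 0 R) {f : Rn n → ℂ} (hf : ContDiff ℝ ∞ f)
    (hsupp : Function.support f ⊆ Metric.closedBall 0 r) {x : Rn n} (hx : R + r < ‖x‖) :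
    distConv u f x = 0 := by
  have hc : HasCompactSupport f := HasCompactSupport.intro (isCompact_closedBall 0 r)
    fun y hy => by_contra fun h0 => hy (hsupp h0)
  have key : ∀ A : ℂ →L[ℝ] ℝ, u (reflTest A f hf hc x) = 0 := by
    refine fun A => eq_zero_of_disjoint_dsupport u _ ?_
    have hsub : tsupport (reflTest A f hf hc x) ⊆ Metric.closedBall x r := by
      refine closure_minimal (fun y hy => ?_) Metric.isClosed_closedBall
      have h1 : f (x - y) ≠ 0 := fun h0 => hy (by rw [reflTest_apply, h0, map_zero])
      have h2 : ‖x - y‖ ≤ r := by simpa using hsupp h1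
      rwa [Metric.mem_closedBall, dist_comm, dist_eq_norm]
    rw [Set.disjoint_left]
    intro y hy hyu
    have h1 : ‖x - y‖ ≤ r := by
      have := hsub hy
      rwa [Metric.mem_closedBall, dist_comm, dist_eq_norm] at this
    have h2 : ‖y‖ ≤ R := by simpa using hu hyu
    have h3 : ‖x‖ ≤ ‖x - y‖ + ‖y‖ := by simpa using norm_add_le (x - y) y
    linarith
  rw [distConv_of_test u hf hc, key, key]
  simp

end Convolution

/-! ### First order Taylor remainder -/

section Remainder

variable {E F : Type*} [NormedAddCommGroup E] [NormedSpace ℝ E] [NormedAddCommGroup F]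
  [NormedSpace ℝ F]

/-- The remainder of the first order Taylor expansion of `f` in the direction `h`. -/
noncomputable def taylorRem (f : E → F) (h z : E) : F := f (z + h) - f z - fderiv ℝ f z h

/-- The mean value inequality is used twice: for `fderiv ℝ f`, which varies by at most `M ‖h‖` on
the ball about `z`, and then for `f` minus its linear part. -/
theorem norm_taylorRem_le {f : E → F} (hf : ContDiff ℝ ∞ f) {M : ℝ}
    (hM : ∀ x, ‖iteratedFDeriv ℝ 2 f x‖ ≤ M) (h z : E) : ‖taylorRem f h z‖ ≤ M * ‖h‖ ^ 2 := by
  have hM' : ∀ x, ‖fderiv ℝ (fderiv ℝ f) x‖ ≤ M := fun x => by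
    have h1 : ‖iteratedFDeriv ℝ 0 (fderiv ℝ (fderiv ℝ f)) x‖ = ‖iteratedFDeriv ℝ 2 f x‖ := by
      rw [norm_iteratedFDeriv_fderiv, norm_iteratedFDeriv_fderiv]
    rw [norm_iteratedFDeriv_zero] at h1
    rw [h1]
    exact hM x
  have hM0 : 0 ≤ M := (norm_nonneg _).trans (hM z)
  have hd : Differentiable ℝ (fderiv ℝ f) :=
    (hf.fderiv_right (m := ∞) (by simp)).differentiable (by simp)
  have h2 := Convex.norm_image_sub_le_of_norm_fderiv_le' (f := f) (φ := fderiv ℝ f z)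
    (C := M * ‖h‖) (s := Metric.closedBall z ‖h‖) (x := z) (y := z + h)
    (fun x _ => hf.differentiable (by simp) x)
    (fun x hx => by
      refine (Convex.norm_image_sub_le_of_norm_fderiv_le (f := fderiv ℝ f) (C := M)
        (fun y _ => hd y) (fun y _ => hM' y) convex_univ (Set.mem_univ z) (Set.mem_univ x)).trans ?_
      gcongr
      simpa [dist_eq_norm] using hx)
    (convex_closedBall z ‖h‖) (by simp) (by simp)
  rw [add_sub_cancel_left] at h2
  rw [taylorRem, pow_two, ← mul_assoc]
  exact h2

theorem contDiff_taylorRem {f : E → F} (hf : ContDiff ℝ ∞ f) (h : E) :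
    ContDiff ℝ ∞ (taylorRem f h) :=
  ((hf.comp (contDiff_id.add contDiff_const)).sub hf).sub (contDiff_fderiv_apply_const hf h)

theorem fderiv_taylorRem {f : E → F} (hf : ContDiff ℝ ∞ f) (h : E) :
    fderiv ℝ (taylorRem f h) = taylorRem (fderiv ℝ f) h := by
  have hd : Differentiable ℝ f := hf.differentiable (by simp)
  ext z v
  have h1 : DifferentiableAt ℝ (fun z => f (z + h)) z :=
    (hd (z + h)).comp z (differentiableAt_id.add_const h)
  have h2 : DifferentiableAt ℝ (fun z => fderiv ℝ f z h) z :=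
    (contDiff_fderiv_apply_const hf h).differentiable (by simp) z
  unfold taylorRem
  rw [fderiv_fun_sub (f := fun z => f (z + h) - f z) (h1.sub (hd z)) h2,
    fderiv_fun_sub h1 (hd z), fderiv_comp_add_right]
  simp only [sub_apply]
  rw [fderiv_fderiv_apply hf, fderiv_fderiv_comm hf]

end Remainder

/-- Taking the remainder commutes with differentiation, so the induction replaces `f` by `fderiv ℝ
f`. This changes the target space, hence `F` is quantified inside, in the universe of `E`. -/
theorem norm_iteratedFDeriv_taylorRem_le.{v} {E : Type v} [NormedAddCommGroup E] [NormedSpace ℝ E]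
    (h z : E) (i : ℕ) : ∀ {F : Type v} [NormedAddCommGroup F] [NormedSpace ℝ F] {f : E → F},
      ContDiff ℝ ∞ f → ∀ {M : ℝ}, (∀ x, ‖iteratedFDeriv ℝ (i + 2) f x‖ ≤ M) →
        ‖iteratedFDeriv ℝ i (taylorRem f h) z‖ ≤ M * ‖h‖ ^ 2 := by
  induction i with
  | zero =>
    intro F _ _ f hf M hM
    rw [norm_iteratedFDeriv_zero]
    exact norm_taylorRem_le hf hM h z
  | succ i ih =>
    intro F _ _ f hf M hM
    rw [← norm_iteratedFDeriv_fderiv, fderiv_taylorRem hf]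
    refine ih (hf.fderiv_right (m := ∞) (by simp)) fun x => ?_
    rw [norm_iteratedFDeriv_fderiv]
    exact hM x

/-! ### Smoothness of the convolution -/

section Smoothness

open TopologicalSpace Asymptotics

variable {n : ℕ}

theorem exists_norm_iteratedFDeriv_le {f : Rn n → ℂ} (hf : ContDiff ℝ ∞ f)
    (hc : HasCompactSupport f) (m : ℕ) :
    ∃ M : ℝ, 0 ≤ M ∧ ∀ i ≤ m, ∀ x, ‖iteratedFDeriv ℝ i f x‖ ≤ M := by
  have h : ∀ i, ∃ C, ∀ x, ‖iteratedFDeriv ℝ i f x‖ ≤ C := fun i =>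
    (hf.continuous_iteratedFDeriv (WithTop.coe_le_coe.2 le_top)).bounded_above_of_compact_support
      (hc.iteratedFDeriv i)
  choose C hC using h
  have hC0 : ∀ i, 0 ≤ C i := fun i => (norm_nonneg _).trans (hC i 0)
  refine ⟨∑ i ∈ Finset.range (m + 1), C i, Finset.sum_nonneg fun i _ => hC0 i, fun i hi x => ?_⟩
  exact (hC i x).trans (Finset.single_le_sum (f := C) (fun i _ => hC0 i)
    (Finset.mem_range.2 (by omega)))

theorem hasCompactSupport_fderiv_apply {f : Rn n → ℂ} (hc : HasCompactSupport f) (v : Rn n) :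
    HasCompactSupport fun x => fderiv ℝ f x v :=
  hc.fderiv_apply ℝ v

/-- The derivative of `u ∗ f` at `x`. -/
noncomputable def distConvFDeriv (u : 𝓓'((⊤ : Opens (Rn n)), ℂ)) {f : Rn n → ℂ}
    (hf : ContDiff ℝ ∞ f) (hc : HasCompactSupport f) (x : Rn n) : Rn n →L[ℝ] ℂ :=
  LinearMap.toContinuousLinearMap
    { toFun := fun v => distConv u (fun y => fderiv ℝ f y v) x
      map_add' := fun v w => by
        simp only [map_add]
        exact distConv_add u (contDiff_fderiv_apply_const hf v)
          (hasCompactSupport_fderiv_apply hc v) (contDiff_fderiv_apply_const hf w)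
          (hasCompactSupport_fderiv_apply hc w) x
      map_smul' := fun c v => by
        simp only [map_smul]
        exact distConv_smul u c (contDiff_fderiv_apply_const hf v)
          (hasCompactSupport_fderiv_apply hc v) x }

theorem distConv_taylorRem (u : 𝓓'((⊤ : Opens (Rn n)), ℂ)) {f : Rn n → ℂ}
    (hf : ContDiff ℝ ∞ f) (hc : HasCompactSupport f) (x h : Rn n) :
    distConv u (taylorRem f h) x
      = distConv u f (x + h) - distConv u f x - distConvFDeriv u hf hc x h := by
  have h1 : ContDiff ℝ ∞ fun y => f (y + h) := hf.comp (contDiff_id.add contDiff_const)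
  have h1c : HasCompactSupport fun y => f (y + h) := hc.comp_homeomorph (Homeomorph.addRight h)
  have h2 := contDiff_fderiv_apply_const hf h
  have h2c := hasCompactSupport_fderiv_apply hc h
  have h3 : ContDiff ℝ ∞ fun y => (-1 : ℝ) • f y := hf.const_smul _
  have h3c : HasCompactSupport fun y => (-1 : ℝ) • f y :=
    hc.comp_left (g := fun z : ℂ => (-1 : ℝ) • z) (smul_zero _)
  have h4 : ContDiff ℝ ∞ fun y => (-1 : ℝ) • fderiv ℝ f y h := h2.const_smul _
  have h4c : HasCompactSupport fun y => (-1 : ℝ) • fderiv ℝ f y h :=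
    h2c.comp_left (g := fun z : ℂ => (-1 : ℝ) • z) (smul_zero _)
  have hrem : taylorRem f h
      = fun y => (f (y + h) + (-1 : ℝ) • f y) + (-1 : ℝ) • fderiv ℝ f y h := by
    ext y
    simp only [taylorRem, neg_smul, one_smul]
    ring
  rw [hrem, distConv_add u (h1.add h3) (h1c.add h3c) h4 h4c, distConv_add u h1 h1c h3 h3c,
    distConv_smul u _ hf hc, distConv_smul u _ h2 h2c, distConv_translate u hf hc]
  simp only [neg_smul, one_smul]
  rw [← sub_eq_add_neg, ← sub_eq_add_neg]
  rfl

/-- The Taylor remainder of `u ∗ f` is `u` convolved with that of `f`, whose derivatives up to the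
order of `u` are `O(‖h‖²)`. -/
theorem hasFDerivAt_distConv (u : 𝓓'((⊤ : Opens (Rn n)), ℂ)) {f : Rn n → ℂ}
    (hf : ContDiff ℝ ∞ f) (hc : HasCompactSupport f) (x : Rn n) :
    HasFDerivAt (distConv u f) (distConvFDeriv u hf hc x) x := by
  obtain ⟨r, hr⟩ := hc.isCompact.isBounded.subset_closedBall (0 : Rn n)
  -- For `‖h‖ ≤ 1` the remainder is supported in the ball of radius `r + 1`.
  obtain ⟨C, hC, m, hCm⟩ := exists_norm_distConv_le u ‖x‖ (r + 1)
  obtain ⟨M, hM, hMf⟩ := exists_norm_iteratedFDeriv_le hf hc (m + 2)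
  rw [hasFDerivAt_iff_isLittleO_nhds_zero]
  have hO : (fun h => distConv u f (x + h) - distConv u f x - distConvFDeriv u hf hc x h)
      =O[nhds 0] fun h : Rn n => ‖h‖ ^ 2 := by
    refine IsBigO.of_bound (C * M) ?_
    filter_upwards [Metric.closedBall_mem_nhds (0 : Rn n) one_pos] with h hh
    have hh1 : ‖h‖ ≤ 1 := by simpa using hh
    rw [← distConv_taylorRem u hf hc, Real.norm_of_nonneg (by positivity), mul_assoc]
    refine hCm _ _ (contDiff_taylorRem hf h) (by positivity) (fun z hz => ?_) (fun i hi z => ?_)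
      x le_rfl
    · by_contra hz'
      have hz1 : r + 1 < ‖z‖ := by simpa using hz'
      have h0 : ∀ y : Rn n, r < ‖y‖ → y ∉ tsupport f := fun y hy hy' => by
        have := hr hy'
        rw [mem_closedBall_zero_iff] at this
        linarith
      have hzh : r < ‖z + h‖ := by
        have := norm_sub_le (z + h) h
        rw [add_sub_cancel_right] at this
        linarith
      have e1 := image_eq_zero_of_notMem_tsupport (h0 _ hzh)
      have hzs := h0 z (by linarith)
      have e2 := image_eq_zero_of_notMem_tsupport hzs
      have e3 : fderiv ℝ f z = 0 := by
        by_contra hne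
        exact hzs (support_fderiv_subset ℝ hne)
      exact hz (by simp [taylorRem, e1, e2, e3])
    · exact norm_iteratedFDeriv_taylorRem_le h z i hf fun y => hMf (i + 2) (by omega) y
  exact hO.trans_isLittleO (isLittleO_norm_pow_id one_lt_two)

theorem fderiv_distConv_apply (u : 𝓓'((⊤ : Opens (Rn n)), ℂ)) {f : Rn n → ℂ}
    (hf : ContDiff ℝ ∞ f) (hc : HasCompactSupport f) (v : Rn n) :
    (fun x => fderiv ℝ (distConv u f) x v) = distConv u fun y => fderiv ℝ f y v := by
  ext x
  rw [(hasFDerivAt_distConv u hf hc x).fderiv]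
  rfl

theorem contDiff_distConv (u : 𝓓'((⊤ : Opens (Rn n)), ℂ)) {f : Rn n → ℂ}
    (hf : ContDiff ℝ ∞ f) (hc : HasCompactSupport f) : ContDiff ℝ ∞ (distConv u f) := by
  have hd : ∀ {f : Rn n → ℂ}, ContDiff ℝ ∞ f → HasCompactSupport f →
      Differentiable ℝ (distConv u f) := fun hf hc x =>
    (hasFDerivAt_distConv u hf hc x).differentiableAt
  rw [contDiff_infty]
  intro k
  induction k generalizing f with
  | zero => exact contDiff_zero.2 (hd hf hc).continuous
  | succ k ih =>
    rw [Nat.cast_succ, contDiff_succ_iff_fderiv_apply]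
    refine ⟨hd hf hc, fun h => absurd h (by simp), fun v => ?_⟩
    rw [fderiv_distConv_apply u hf hc]
    exact ih (contDiff_fderiv_apply_const hf v) (hasCompactSupport_fderiv_apply hc v)

theorem hasCompactSupport_listDeriv {f : Rn n → ℂ} (hc : HasCompactSupport f) (L : List (Rn n)) :
    HasCompactSupport (listDeriv L f) := by
  induction L with
  | nil => exact hc
  | cons v L ih => exact hasCompactSupport_fderiv_apply ih v

theorem listDeriv_distConv (u : 𝓓'((⊤ : Opens (Rn n)), ℂ)) {f : Rn n → ℂ}
    (hf : ContDiff ℝ ∞ f) (hc : HasCompactSupport f) (L : List (Rn n)) :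
    listDeriv L (distConv u f) = distConv u (listDeriv L f) := by
  induction L with
  | nil => rfl
  | cons v L ih =>
    rw [listDeriv_cons, ih]
    exact fderiv_distConv_apply u (contDiff_listDeriv L hf) (hasCompactSupport_listDeriv hc L) v

/-- The derivatives of `u ∗ f` are bounded by those of `f`, locally uniformly. -/
theorem exists_norm_iteratedFDeriv_distConv_le (u : 𝓓'((⊤ : Opens (Rn n)), ℂ)) (R r : ℝ) :
    ∃ C : ℝ, 0 ≤ C ∧ ∃ m : ℕ, ∀ (f : Rn n → ℂ) (k : ℕ) (B : ℝ), ContDiff ℝ ∞ f → 0 ≤ B →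
      Function.support f ⊆ Metric.closedBall 0 r →
      (∀ i ≤ m, ∀ x, ‖iteratedFDeriv ℝ (k + i) f x‖ ≤ B) →
      ∀ x : Rn n, ‖x‖ ≤ R → ‖iteratedFDeriv ℝ k (distConv u f) x‖ ≤ C * B := by
  obtain ⟨C, hC, m, h⟩ := exists_norm_distConv_le u R r
  refine ⟨C, hC, m, fun f k B hf hB hsupp hfB x hx => ?_⟩
  have hc : HasCompactSupport f := HasCompactSupport.intro (isCompact_closedBall 0 r)
    fun y hy => by_contra fun h0 => hy (hsupp h0)
  refine ContinuousMultilinearMap.opNorm_le_bound (by positivity) fun v => ?_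
  rw [iteratedFDeriv_apply_eq_listDeriv (contDiff_distConv u hf hc), listDeriv_distConv u hf hc,
    mul_assoc]
  have hP : 0 ≤ ∏ i, ‖v i‖ := Finset.prod_nonneg fun _ _ => norm_nonneg _
  refine h _ _ (contDiff_listDeriv _ hf) (by positivity)
    (support_listDeriv_subset Metric.isClosed_closedBall hsupp _) (fun i hi y => ?_) x hx
  refine (norm_iteratedFDeriv_listDeriv_le hf _ y i).trans ?_
  rw [List.map_ofFn, List.prod_ofFn, List.length_ofFn, add_comm i k, mul_comm]
  exact mul_le_mul_of_nonneg_right (hfB i hi y) hP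

end Smoothness

end GevreyReg

namespace GevreyReg

/-! ### The regularised net -/

section Net

open TopologicalSpace MeasureTheory

variable {n : ℕ} {σ : ℝ}

theorem mem_Ioo_of_le_exp {ε : ℝ} (hε : ε ∈ Set.Ioc 0 (Real.exp (-2))) :
    ε ∈ Set.Ioo (0 : ℝ) 1 :=
  ⟨hε.1, hε.2.trans_lt (Real.exp_lt_one_iff.2 (by norm_num))⟩

/-- The cutoff factor vanishes for `‖x‖ ≥ 2 / |log ε|`, which is at most `1` because `ε ≤ e⁻²`. -/
theorem support_rho_subset (φ : Rn n → ℂ) {χ : Rn n → ℝ} (hχ : IsCutoff σ χ) {ε : ℝ}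
    (hε : ε ∈ Set.Ioc 0 (Real.exp (-2))) :
    Function.support (rho φ χ ε) ⊆ Metric.closedBall 0 1 := by
  intro x hx
  by_contra hx1
  have hx1 : 1 < ‖x‖ := by simpa using hx1
  have hlog : 2 ≤ |Real.log ε| := by
    have h : Real.log ε ≤ -2 := (Real.log_le_iff_le_exp hε.1).2 hε.2
    rw [abs_of_nonpos (by linarith)]
    linarith
  refine hx ?_
  have h2 : 2 ≤ ‖|Real.log ε| • x‖ := by
    rw [norm_smul, Real.norm_eq_abs, abs_abs]
    nlinarith
  simp [rho, hχ.2.2.1 _ h2]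

theorem tsupport_distConv_subset (u : 𝓓'((⊤ : Opens (Rn n)), ℂ)) {R r : ℝ}
    (hu : Distribution.dsupport u ⊆ Metric.closedBall 0 R) {f : Rn n → ℂ} (hf : ContDiff ℝ ∞ f)
    (hsupp : Function.support f ⊆ Metric.closedBall 0 r) :
    tsupport (distConv u f) ⊆ Metric.closedBall 0 (R + r) := by
  refine closure_minimal (fun x hx => ?_) Metric.isClosed_closedBall
  by_contra hx'
  exact hx (distConv_eq_zero u hu hf hsupp (by simpa using hx'))

theorem exists_norm_iteratedFDeriv_distConv_rho_le (hσ : 0 ≤ σ) {φ : Rn n → ℂ}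
    (hφ : IsMollifier σ φ) {χ : Rn n → ℝ} (hχ : IsCutoff σ χ)
    (u : 𝓓'((⊤ : Opens (Rn n)), ℂ)) {R : ℝ}
    (hu : Distribution.dsupport u ⊆ Metric.closedBall 0 R) :
    ∃ M B : ℝ, 1 ≤ M ∧ 1 ≤ B ∧ ∃ N : ℕ, ∀ (k : ℕ) (x : Rn n),
      ∀ ε ∈ Set.Ioc 0 (Real.exp (-2)),
        ‖iteratedFDeriv ℝ k (distConv u (rho φ χ ε)) x‖
          ≤ M * B ^ k * gevreyWeight σ k * (ε ^ (k + N))⁻¹ := by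
  obtain ⟨M₀, B₀, hM₀, hB₀, h₀⟩ := norm_iteratedFDeriv_rho_le hσ hφ.1 hχ
  obtain ⟨C, hC, m, h⟩ := exists_norm_iteratedFDeriv_distConv_le u (R + 1) 1
  obtain ⟨M, B, hM, hB, hshift⟩ := exists_bound_shift hσ hM₀ hB₀ m
  -- In the exponent `n + m`, `n` comes from the normalisation of `ρ_ε` and `m` from the order of
  -- `u`.
  refine ⟨(1 + C) * M, B, one_le_mul_of_one_le_of_one_le (by linarith) hM, hB, n + m,
    fun k x ε hε => ?_⟩
  have hε1 := mem_Ioo_of_le_exp hε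
  have hε0 := hε1.1
  have hw := zero_le_one.trans (one_le_gevreyWeight hσ k)
  obtain ⟨hs, hc⟩ := rho_test hφ hχ hε1
  have hsupp := support_rho_subset φ hχ hε
  rcases le_or_gt ‖x‖ (R + 1) with hx | hx
  · refine (h _ k (M * B ^ k * gevreyWeight σ k * (ε ^ (k + (n + m)))⁻¹) hs (by positivity) hsupp
      (fun i hi y => ?_) x hx).trans ?_
    · refine (h₀ (k + i) y ε hε1).trans ?_
      have hi' : (ε ^ (n + (k + i)))⁻¹ ≤ (ε ^ (k + (n + m)))⁻¹ := by
        refine inv_anti₀ (by positivity) ?_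
        exact pow_le_pow_of_le_one hε0.le hε1.2.le (by omega)
      exact mul_le_mul (hshift k i hi) hi' (by positivity) (by positivity)
    · rw [← mul_assoc, ← mul_assoc, ← mul_assoc]
      gcongr
      linarith
  · have h0 : iteratedFDeriv ℝ k (distConv u (rho φ χ ε)) x = 0 := by
      by_contra hne
      have := tsupport_distConv_subset u hu hs hsupp (support_iteratedFDeriv_subset k hne)
      rw [mem_closedBall_zero_iff] at this
      linarith
    rw [h0, norm_zero]
    have : 0 ≤ 1 + C := by linarith
    positivity

theorem exists_norm_mderiv_distConv_rho_le (hσ : 0 ≤ σ) {φ : Rn n → ℂ}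
    (hφ : IsMollifier σ φ) {χ : Rn n → ℝ} (hχ : IsCutoff σ χ)
    (u : 𝓓'((⊤ : Opens (Rn n)), ℂ)) {R : ℝ}
    (hu : Distribution.dsupport u ⊆ Metric.closedBall 0 R) :
    ∃ C : ℝ, 0 < C ∧ ∃ N : ℕ, ∀ α : Fin n → ℕ, ∀ x : Rn n, ∀ ε ∈ Set.Ioc 0 (Real.exp (-2)),
      ‖mderiv α (distConv u (rho φ χ ε)) x‖ ≤
        C ^ (mlen α + 1) * mfact α ^ σ * ε ^ (-(mlen α : ℤ) - (N : ℤ)) := by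
  obtain ⟨M, B, hM, hB, N, h⟩ := exists_norm_iteratedFDeriv_distConv_rho_le hσ hφ hχ u hu
  have hn : (1 : ℝ) ≤ ((n : ℝ) + 1) ^ σ := Real.one_le_rpow (by simp) hσ
  set D := B * ((n : ℝ) + 1) ^ σ with hD
  have hD1 : 1 ≤ D := one_le_mul_of_one_le_of_one_le hB hn
  refine ⟨M * D, by positivity, N, fun α x ε hε => ?_⟩
  have hε0 := hε.1
  have hm0 := zero_le_one.trans (one_le_mfact α)
  have hz : ε ^ (-(mlen α : ℤ) - (N : ℤ)) = (ε ^ (mlen α + N))⁻¹ := by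
    rw [← neg_add', zpow_neg, ← Nat.cast_add, zpow_natCast]
  rw [hz]
  refine (norm_mderiv_le α _ x).trans ((h (mlen α) x ε hε).trans ?_)
  refine mul_le_mul_of_nonneg_right ?_ (by positivity)
  have hw : gevreyWeight σ (mlen α) ≤ (((n : ℝ) + 1) ^ σ) ^ mlen α * mfact α ^ σ := by
    rw [← Real.rpow_natCast, ← Real.rpow_mul (by positivity), mul_comm σ,
      Real.rpow_mul (by positivity), Real.rpow_natCast,
      ← Real.mul_rpow (by positivity) hm0]
    refine Real.rpow_le_rpow (by positivity) ((factorial_le_pow_mul_mfact α).trans ?_) hσ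
    gcongr
    simp
  calc M * B ^ mlen α * gevreyWeight σ (mlen α)
      ≤ M * B ^ mlen α * ((((n : ℝ) + 1) ^ σ) ^ mlen α * mfact α ^ σ) := by gcongr
    _ = M * D ^ mlen α * mfact α ^ σ := by rw [hD, mul_pow]; ring
    _ ≤ (M * D) ^ (mlen α + 1) * mfact α ^ σ := by
        refine mul_le_mul_of_nonneg_right ?_ (by positivity)
        rw [mul_pow M D]
        exact mul_le_mul (le_self_pow₀ hM (Nat.succ_ne_zero _))
          (pow_le_pow_right₀ hD1 (Nat.le_succ _)) (by positivity) (by positivity)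

theorem isGevreyModerate_of_bound {η C : ℝ} (hη : η ≤ 1) (hC : 0 < C) {N : ℕ}
    {f : ℝ → Rn n → ℂ} (hf : ∀ ε ∈ Set.Ioc 0 η, ContDiff ℝ ∞ (f ε))
    (h : ∀ α : Fin n → ℕ, ∀ x : Rn n, ∀ ε ∈ Set.Ioc 0 η, ‖mderiv α (f ε) x‖ ≤
      C ^ (mlen α + 1) * mfact α ^ σ * ε ^ (-(mlen α : ℤ) - (N : ℤ))) :
    IsGevreyModerate σ η f := by
  -- For a single `ε` the power of `ε⁻¹` goes into the Gevrey constant, since `|α| + N ≤ (N + 1)(|α|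
  -- + 1)`.
  refine ⟨fun ε hε => ⟨hf ε hε, fun K _ => ⟨C * (ε⁻¹) ^ (N + 1), ?_, fun α x _ => ?_⟩⟩,
    fun K _ => ⟨C, hC, N, fun α x _ ε hε => ?_⟩⟩
  · have := hε.1
    positivity
  · have hε0 := hε.1
    have hε1 : 1 ≤ ε⁻¹ := (one_le_inv₀ hε0).2 (hε.2.trans hη)
    have hm0 := zero_le_one.trans (one_le_mfact α)
    refine (h α x ε hε).trans ?_
    have hz : ε ^ (-(mlen α : ℤ) - (N : ℤ)) ≤ ((ε⁻¹) ^ (N + 1)) ^ (mlen α + 1) := by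
      rw [← neg_add', zpow_neg, ← Nat.cast_add, zpow_natCast, ← inv_pow, ← pow_mul]
      exact pow_le_pow_right₀ hε1 (by nlinarith [Nat.zero_le (N * mlen α)])
    rw [mul_pow, mul_right_comm]
    gcongr
  · rw [show -(N : ℤ) - (mlen α : ℤ) = -(mlen α : ℤ) - (N : ℤ) by ring]
    exact h α x ε hε

end Net

/-! ### Decay of the Fourier transform -/

section FourierDecay

open MeasureTheory

/-- Gevrey growth of the moments gives stretched exponential decay. -/
theorem le_exp_of_pow_mul_le {σ t Q P D : ℝ} (hσ : 0 < σ) (ht : 0 ≤ t) (hQ : 0 ≤ Q) (hP : 0 ≤ P)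
    (hD : 0 < D) (h : ∀ k : ℕ, t ^ k * Q ≤ P * D ^ k * gevreyWeight σ k) :
    Q ≤ 2 ^ σ * P * Real.exp (-(σ / 2) * (t / D) ^ (1 / σ)) := by
  set s := (t / D) ^ (1 / σ) with hs
  set q := Q ^ (1 / σ) with hq
  set p := P ^ (1 / σ) with hp
  have htD : 0 ≤ t / D := by positivity
  have hinv : 0 ≤ 1 / σ := by positivity
  -- Taking `1/σ`-th powers turns `(k!)^σ` into `k!`.
  have h1 : ∀ k : ℕ, s ^ k * q ≤ p * k.factorial := fun k => by
    have hk : (t / D) ^ k * Q ≤ P * gevreyWeight σ k := by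
      rw [div_pow, div_mul_eq_mul_div, div_le_iff₀ (by positivity)]
      linarith [h k]
    have hk' := Real.rpow_le_rpow (by positivity) hk hinv
    rw [Real.mul_rpow (by positivity) hQ, Real.mul_rpow hP (by unfold gevreyWeight; positivity),
      gevreyWeight, ← Real.rpow_mul (by positivity), mul_one_div_cancel hσ.ne', Real.rpow_one,
      ← Real.rpow_natCast, ← Real.rpow_mul htD, mul_comm (k : ℝ), Real.rpow_mul htD,
      Real.rpow_natCast] at hk'
    exact hk'
  -- Divide by `2^k k!` and sum over `k`: an exponential series against a geometric one.
  have h2 : Real.exp (s / 2) * q ≤ 2 * p := by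
    have e1 : HasSum (fun k : ℕ => (s / 2) ^ k / k.factorial * q) (Real.exp (s / 2) * q) := by
      rw [Real.exp_eq_exp_ℝ]
      exact (NormedSpace.expSeries_div_hasSum_exp (s / 2)).mul_right q
    refine hasSum_le (fun k => ?_) e1 (hasSum_geometric_two.mul_right p)
    have hf : (0 : ℝ) < k.factorial := by positivity
    rw [div_pow, div_div, div_mul_eq_mul_div, div_le_iff₀ (by positivity), div_pow, one_pow]
    have := h1 k
    field_simp
    linarith
  have hp0 : 0 ≤ p := by positivity
  have h3 : q ≤ 2 * p * Real.exp (-(s / 2)) := by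
    rw [Real.exp_neg, ← div_eq_mul_inv, le_div_iff₀ (Real.exp_pos _)]
    linarith
  have h4 := Real.rpow_le_rpow (by positivity) h3 hσ.le
  rw [hq, ← Real.rpow_mul hQ, one_div_mul_cancel hσ.ne', Real.rpow_one,
    Real.mul_rpow (by positivity) (Real.exp_pos _).le, Real.mul_rpow (by norm_num) hp0, hp,
    ← Real.rpow_mul hP, one_div_mul_cancel hσ.ne', Real.rpow_one, ← Real.exp_mul] at h4
  refine h4.trans (le_of_eq ?_)
  congr 2
  ring

variable {n : ℕ} {σ : ℝ}

/-- Since `1/σ ≤ 1`, the power `t ↦ t^(1/σ)` is subadditive. -/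
theorem jap_rpow_le (hσ : 1 ≤ σ) (ξ : Rn n) : jap ξ ^ (1 / σ) ≤ 1 + ‖ξ‖ ^ (1 / σ) := by
  have h0 : 0 ≤ 1 / σ := by positivity
  have h1 : 1 / σ ≤ 1 := (div_le_one (by linarith)).2 hσ
  have hj : jap ξ ≤ 1 + ‖ξ‖ :=
    Real.sqrt_le_iff.2 ⟨by positivity, by nlinarith [norm_nonneg ξ]⟩
  refine (Real.rpow_le_rpow (Real.sqrt_nonneg _) hj h0).trans ?_
  simpa using Real.rpow_add_le_add_rpow zero_le_one (norm_nonneg ξ) h0 h1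

theorem integral_norm_iteratedFDeriv_le {f : Rn n → ℂ} {r C : ℝ} {k : ℕ}
    (hsupp : tsupport f ⊆ Metric.closedBall 0 r) (hC : ∀ x, ‖iteratedFDeriv ℝ k f x‖ ≤ C) :
    ∫ x, ‖iteratedFDeriv ℝ k f x‖ ≤ C * volume.real (Metric.closedBall (0 : Rn n) r) := by
  rw [← setIntegral_eq_integral_of_forall_compl_eq_zero (s := Metric.closedBall (0 : Rn n) r)
    (fun x hx => by
      rw [norm_eq_zero]
      by_contra hne
      exact hx (hsupp (support_iteratedFDeriv_subset k hne)))]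
  refine (Real.le_norm_self _).trans ?_
  exact norm_setIntegral_le_of_norm_le_const (isCompact_closedBall _ _).measure_lt_top
    fun x _ => by rw [norm_norm]; exact hC x

theorem exists_norm_hat_le (hσ : 1 ≤ σ) {η r M B : ℝ} (hη0 : 0 < η) (hη : η < 1) (hM : 1 ≤ M)
    (hB : 1 ≤ B) {N : ℕ} {f : ℝ → Rn n → ℂ} (hf : ∀ ε ∈ Set.Ioc 0 η, ContDiff ℝ ∞ (f ε))
    (hsupp : ∀ ε ∈ Set.Ioc 0 η, tsupport (f ε) ⊆ Metric.closedBall 0 r)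
    (hb : ∀ (k : ℕ) (x : Rn n), ∀ ε ∈ Set.Ioc 0 η,
      ‖iteratedFDeriv ℝ k (f ε) x‖ ≤ M * B ^ k * gevreyWeight σ k * (ε ^ (k + N))⁻¹) :
    ∃ c : ℝ, 0 < c ∧ ∃ N : ℕ, ∀ ξ : Rn n, ∀ ε ∈ Set.Ioc 0 η,
      ‖hat (f ε) ξ‖ ≤ c * ε ^ (-(N : ℤ)) * Real.exp (-c * ε ^ (1 / σ) * jap ξ ^ (1 / σ)) := by
  have hσ0 : 0 < σ := by linarith
  set v := volume.real (Metric.closedBall (0 : Rn n) r)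
  have hv : 0 ≤ v := measureReal_nonneg
  -- This is the rate given by `le_exp_of_pow_mul_le` with `D = 4 * B`; the factor `(2π)⁻¹` comes
  -- from the normalisation of `hat`.
  set c := σ / 2 * ((2 * Real.pi)⁻¹ / (4 * B)) ^ (1 / σ) with hc
  have hc0 : 0 < c := by positivity
  set A := 2 ^ σ * (v * M) * Real.exp c with hA
  have hA0 : 0 ≤ A := by positivity
  -- The same `c` must serve as rate and as prefactor. As `η < 1`, the excess constant `A` is
  -- absorbed by `ε^(-p)`.
  obtain ⟨p, hp⟩ := pow_unbounded_of_one_lt (A / c) ((one_lt_inv₀ hη0).2 hη)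
  refine ⟨c, hc0, N + p, fun ξ ε hε => ?_⟩
  have hε0 := hε.1
  have hε1 : ε ≤ 1 := hε.2.trans hη.le
  set w := (2 * Real.pi)⁻¹ • ξ with hw
  have hwn : ‖w‖ = (2 * Real.pi)⁻¹ * ‖ξ‖ := by
    rw [hw, norm_smul, Real.norm_of_nonneg (by positivity)]
  have hcs : HasCompactSupport (f ε) :=
    (isCompact_closedBall (0 : Rn n) r).of_isClosed_subset (isClosed_tsupport _) (hsupp ε hε)
  have hint : ∀ q, Integrable (iteratedFDeriv ℝ q (f ε)) := fun q =>
    ((hf ε hε).continuous_iteratedFDeriv (WithTop.coe_le_coe.2 le_top)).integrable_of_hasCompactSupport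
      (hcs.iteratedFDeriv q)
  have hmom : ∀ k : ℕ, (ε * ‖w‖) ^ k * ‖hat (f ε) ξ‖
      ≤ (v * M * (ε ^ N)⁻¹) * (4 * B) ^ k * gevreyWeight σ k := fun k => by
    have hwk := zero_le_one.trans (one_le_gevreyWeight hσ0.le k)
    set X := M * B ^ k * gevreyWeight σ k * (ε ^ (k + N))⁻¹ with hX
    have hX0 : 0 ≤ X := by positivity
    -- One factor `2^k` comes from the Fourier estimate, the other bounds the `k + 1` summands.
    have h1 : ‖w‖ ^ k * ‖hat (f ε) ξ‖ ≤ 2 ^ k * (2 ^ k * (X * v)) := by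
      refine (pow_mul_norm_fourier_le (hf ε hε) (fun q _ => hint q) w).trans ?_
      refine mul_le_mul_of_nonneg_left ?_ (by positivity)
      calc ∑ q ∈ Finset.range (k + 1), ∫ x, ‖iteratedFDeriv ℝ q (f ε) x‖
          ≤ ∑ _q ∈ Finset.range (k + 1), X * v := by
            refine Finset.sum_le_sum fun q hq => ?_
            have hqk : q ≤ k := Nat.lt_succ_iff.1 (Finset.mem_range.1 hq)
            refine integral_norm_iteratedFDeriv_le (hsupp ε hε) fun x => (hb q x ε hε).trans ?_
            have h2 := gevreyWeight_mono hσ0.le hqk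
            have h3 := zero_le_one.trans (one_le_gevreyWeight hσ0.le q)
            have h4 : (ε ^ (q + N))⁻¹ ≤ (ε ^ (k + N))⁻¹ :=
              inv_anti₀ (by positivity) (pow_le_pow_of_le_one hε0.le hε1 (by omega))
            rw [hX]
            gcongr
        _ = ((k + 1 : ℕ) : ℝ) * (X * v) := by simp
        _ ≤ 2 ^ k * (X * v) := by
            gcongr
            exact_mod_cast Nat.lt_two_pow_self
    calc (ε * ‖w‖) ^ k * ‖hat (f ε) ξ‖ = ε ^ k * (‖w‖ ^ k * ‖hat (f ε) ξ‖) := by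
          rw [mul_pow]; ring
      _ ≤ ε ^ k * (2 ^ k * (2 ^ k * (X * v))) := by gcongr
      _ = _ := by
          rw [hX, pow_add, mul_pow, show (4 : ℝ) = 2 * 2 by norm_num, mul_pow]
          field_simp
  have hdec := le_exp_of_pow_mul_le hσ0 (by positivity) (norm_nonneg _) (by positivity)
    (by positivity) hmom
  have hexp : -(σ / 2) * (ε * ‖w‖ / (4 * B)) ^ (1 / σ)
      = -(c * ε ^ (1 / σ) * ‖ξ‖ ^ (1 / σ)) := by
    have : ε * ‖w‖ / (4 * B) = (2 * Real.pi)⁻¹ / (4 * B) * (ε * ‖ξ‖) := by rw [hwn]; ring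
    rw [this, Real.mul_rpow (by positivity) (by positivity),
      Real.mul_rpow hε0.le (norm_nonneg _), hc]
    ring
  rw [hexp] at hdec
  have he1 : ε ^ (1 / σ) ≤ 1 := Real.rpow_le_one hε0.le hε1 (by positivity)
  have he0 : 0 ≤ ε ^ (1 / σ) := by positivity
  have hj := mul_le_mul_of_nonneg_left (jap_rpow_le hσ ξ) (mul_nonneg hc0.le he0)
  -- Replacing `|ξ|` by `⟨ξ⟩` costs only `e^c`, because `ε ≤ 1`.
  have hexp2 : Real.exp (-(c * ε ^ (1 / σ) * ‖ξ‖ ^ (1 / σ)))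
      ≤ Real.exp c * Real.exp (-c * ε ^ (1 / σ) * jap ξ ^ (1 / σ)) := by
    rw [← Real.exp_add]
    refine Real.exp_le_exp.2 ?_
    have := mul_le_mul_of_nonneg_left he1 hc0.le
    linarith
  have hAp : A ≤ c * (ε ^ p)⁻¹ := by
    have h1 : A ≤ c * (η⁻¹) ^ p := by
      have := (div_lt_iff₀ hc0).1 hp
      linarith
    refine h1.trans ?_
    rw [← inv_pow]
    gcongr
    exact hε.2
  have hz : ε ^ (-((N + p : ℕ) : ℤ)) = (ε ^ p)⁻¹ * (ε ^ N)⁻¹ := by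
    rw [zpow_neg, zpow_natCast, pow_add, mul_inv, mul_comm]
  rw [hz]
  calc ‖hat (f ε) ξ‖
      ≤ 2 ^ σ * (v * M * (ε ^ N)⁻¹)
        * (Real.exp c * Real.exp (-c * ε ^ (1 / σ) * jap ξ ^ (1 / σ))) :=
        hdec.trans (by gcongr)
    _ = A * (ε ^ N)⁻¹ * Real.exp (-c * ε ^ (1 / σ) * jap ξ ^ (1 / σ)) := by rw [hA]; ring
    _ ≤ c * (ε ^ p)⁻¹ * (ε ^ N)⁻¹ * Real.exp (-c * ε ^ (1 / σ) * jap ξ ^ (1 / σ)) := by gcongr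
    _ = _ := by ring

end FourierDecay

end GevreyReg

open GevreyReg in
theorem mainTheorem10 (n : ℕ) (σ : ℝ) (hσ : 1 < σ)
    (φ : Rn n → ℂ) (hφ : IsMollifier σ φ)
    (χ : Rn n → ℝ) (hχ : IsCutoff σ χ)
    (u : 𝓓'((⊤ : TopologicalSpace.Opens (Rn n)), ℂ))
    (hu : IsCompact (Distribution.dsupport u)) :
    ∃ η : ℝ, 0 < η ∧ η < 1 ∧
      (∃ K : Set (Rn n), IsCompact K ∧
        ∀ ε ∈ Set.Ioc 0 η, tsupport (distConv u (rho φ χ ε)) ⊆ K) ∧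
      (∀ ε ∈ Set.Ioc 0 η, ContDiff ℝ ∞ (distConv u (rho φ χ ε))) ∧
      (∃ C : ℝ, 0 < C ∧ ∃ N : ℕ, ∀ α : Fin n → ℕ, ∀ x : Rn n, ∀ ε ∈ Set.Ioc 0 η,
        ‖mderiv α (distConv u (rho φ χ ε)) x‖ ≤
          C ^ (mlen α + 1) * mfact α ^ σ * ε ^ (-(mlen α : ℤ) - (N : ℤ))) ∧
      IsGevreyCModerate σ η (fun ε => distConv u (rho φ χ ε)) ∧
      (∃ c : ℝ, 0 < c ∧ ∃ N : ℕ, ∀ ξ : Rn n, ∀ ε ∈ Set.Ioc 0 η,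
        ‖hat (distConv u (rho φ χ ε)) ξ‖ ≤
          c * ε ^ (-(N : ℤ)) * Real.exp (-c * ε ^ (1 / σ) * jap ξ ^ (1 / σ))) := by
  have hσ0 : 0 ≤ σ := by linarith
  obtain ⟨R, hR⟩ := hu.isBounded.subset_closedBall (0 : Rn n)
  have htest := fun ε (hε : ε ∈ Set.Ioc 0 (Real.exp (-2))) =>
    rho_test hφ hχ (mem_Ioo_of_le_exp hε)
  have hη : Real.exp (-2) < 1 := Real.exp_lt_one_iff.2 (by norm_num)
  have hsmooth : ∀ ε ∈ Set.Ioc 0 (Real.exp (-2)), ContDiff ℝ ∞ (distConv u (rho φ χ ε)) :=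
    fun ε hε => contDiff_distConv u (htest ε hε).1 (htest ε hε).2
  have hsupp : ∀ ε ∈ Set.Ioc 0 (Real.exp (-2)),
      tsupport (distConv u (rho φ χ ε)) ⊆ Metric.closedBall 0 (R + 1) := fun ε hε =>
    tsupport_distConv_subset u hR (htest ε hε).1 (support_rho_subset φ hχ hε)
  obtain ⟨C, hC, N, hb⟩ := exists_norm_mderiv_distConv_rho_le hσ0 hφ hχ u hR
  obtain ⟨M, B, hM, hB, N', hop⟩ := exists_norm_iteratedFDeriv_distConv_rho_le hσ0 hφ hχ u hR
  have hK : ∃ K : Set (Rn n), IsCompact K ∧ ∀ ε ∈ Set.Ioc 0 (Real.exp (-2)),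
      tsupport (distConv u (rho φ χ ε)) ⊆ K :=
    ⟨Metric.closedBall 0 (R + 1), isCompact_closedBall _ _, hsupp⟩
  -- The threshold `η = e⁻²` depends on none of the data.
  exact ⟨Real.exp (-2), Real.exp_pos _, hη, hK, hsmooth, ⟨C, hC, N, hb⟩,
    ⟨isGevreyModerate_of_bound hη.le hC hsmooth hb, hK⟩,
    exists_norm_hat_le hσ.le (Real.exp_pos _) hη hM hB hsmooth hsupp hop⟩
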